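/- Let $\Omega\subset\mathbb{R}^2$ be a bounded Lipschitz domain with boundary $\Gamma=\partial\Omega$ and exterior unit normal $n$. Let $S\subset\Omega$ be a boundary layer, i.e. a Lipschitz domain with $\Gamma\subset\partial S$ together with a (finite) conforming triangulation $\mathcal{T}$ of $\overline S$ into non-degenerate closed triangles, and put $\Gamma^c:=\partial S\setminus\Gamma$. For $p\in\mathbb{N}$, $p\ge 1$, let $$\mathcal{S}^p_{\Gamma^c}(\mathcal{T}):=\{\varphi_h\in C^0(\overline S):\ \varphi_h|_T\text{ is a polynomial of degree at most }p\text{ for all }T\in\mathcal{T},\ \varphi_h=0\text{ on }\Gamma^c\},$$ and for $\varphi_h\in\mathcal{S}^p_{\Gamma^c}(\mathcal{T})$ let $\nabla\varphi_h$ be its piecewise gradient (on $\Gamma$, taken from inside $S$) and $\operatorname{\mathbf{curl}}\varphi_h:=(-\partial_2\varphi_h,\partial_1\varphi_h)$. Let $g\in H^{1/2}(\Gamma)$, i.e. $g$ is the trace of a function in $H^1(\Omega)$, and let $u\in H^1(\Omega)$ be the weak solution of $\Delta u=0$ in $\Omega$ with trace $u|_\Gamma=g$. Let $v\in H^1(\Omega)$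 satisfy $\Delta v=0$ weakly in $\Omega$, with trace $v|_\Gamma$. Consider the discrete problem: find $\widetilde w_h\in\mathcal{S}^p_{\Gamma^c}(\mathcal{T})$ with $$(\nabla\widetilde w_h,\nabla\varphi_h)_{L^2(S)}=(g-v|_\Gamma,\ n\cdot\operatorname{\mathbf{curl}}\varphi_h)_{L^2(\Gamma)}\qquad\text{for all }\varphi_h\in\mathcal{S}^p_{\Gamma^c}(\mathcal{T}).$$ If $\Gamma^c\neq\emptyset$ (equivalently $S\ne\Omega$), this problem has exactly one solution. Moreover, every solution $\widetilde w_h$ (whether or not $\Gamma^c$ is empty) satisfies $$2\,(g-v|_\Gamma,\ n\cdot\operatorname{\mathbf{curl}}\widetilde w_h)_{L^2(\Gamma)}-\|\nabla\widetilde w_h\|_{L^2(S)}^2\ \le\ \|\nabla(u-v)\|_{L^2(\Omega)}^2 .$$ -/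

import Mathlib

open MeasureTheory Filter Topology
open scoped ContDiff RealInnerProductSpace

namespace BoundaryLayer

/-- The Euclidean plane `ℝ²`. -/
abbrev Plane : Type := EuclideanSpace ℝ (Fin 2)

noncomputable section

/-! ### Domains, boundary measure, exterior normal -/

/-- A Lipschitz domain in the plane: a nonempty connected open set which, near each of its boundary
points and in suitable Cartesian coordinates, is the set of points strictly below the graph of a
Lipschitz function. -/
structure IsLipschitzDomain (Ω : Set Plane) : Prop where
  isOpen : IsOpen Ω
  isConnected : IsConnected Ω
  locally_subgraph : ∀ x ∈ frontier Ω, ∃ (e : Plane ≃ᵃⁱ[ℝ] Plane) (K : NNReal) (f : ℝ → ℝ),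
    LipschitzWith K f ∧ ∃ r > 0, ∀ y ∈ Metric.ball x r, (y ∈ Ω ↔ (e y) 1 < f ((e y) 0))

/-- Arc length on the boundary `∂Ω`. -/
def boundaryMeasure (Ω : Set Plane) : Measure Plane :=
  (Measure.hausdorffMeasure 1 : Measure Plane).restrict (frontier Ω)

/-- `n` is the exterior unit normal of `Ω` at `x`: a unit vector such that, infinitesimally at `x`,
the set `Ω` is the half plane `{y | ⟪n, y - x⟫ < 0}`. -/
def IsExteriorNormalAt (Ω : Set Plane) (x n : Plane) : Prop :=
  ‖n‖ = 1 ∧ ∀ ε > 0, ∀ᶠ y in 𝓝 x,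
    (⟪n, y - x⟫ < -(ε * ‖y - x‖) → y ∈ Ω) ∧ (ε * ‖y - x‖ < ⟪n, y - x⟫ → y ∉ closure Ω)

open Classical in
/-- The exterior unit normal field; it is determined at every boundary point where the boundary has
a tangent line, hence almost everywhere on the boundary of a Lipschitz domain (value `0` at the
other points). -/
def exteriorNormal (Ω : Set Plane) (x : Plane) : Plane :=
  if h : ∃ n, IsExteriorNormalAt Ω x n then h.choose else 0

/-! ### The Sobolev space `H¹(Ω)`, traces, harmonic functions -/

/-- `ψ ∈ C_c^∞(Ω)`. -/
def IsTestFunction (Ω : Set Plane) (ψ : Plane → ℝ) : Prop :=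
  ContDiff ℝ ∞ ψ ∧ HasCompactSupport ψ ∧ tsupport ψ ⊆ Ω

/-- `G ∈ L²(Ω)²` is the weak gradient of `φ` in `Ω`. -/
def IsWeakGradient (Ω : Set Plane) (φ : Plane → ℝ) (G : Plane → Plane) : Prop :=
  MemLp G 2 (volume.restrict Ω) ∧
    ∀ ψ, IsTestFunction Ω ψ → ∫ x in Ω, φ x • gradient ψ x = -∫ x in Ω, ψ x • G x

/-- `φ ∈ H¹(Ω)`. -/
def MemH1 (Ω : Set Plane) (φ : Plane → ℝ) : Prop :=
  MemLp φ 2 (volume.restrict Ω) ∧ ∃ G, IsWeakGradient Ω φ G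

open Classical in
/-- The weak gradient of `φ ∈ H¹(Ω)`, unique up to null sets (value `0` if `φ` has none). -/
def weakGradient (Ω : Set Plane) (φ : Plane → ℝ) : Plane → Plane :=
  if h : ∃ G, IsWeakGradient Ω φ G then h.choose else 0

/-- `f ∈ L²(∂Ω)` is the trace of `φ ∈ H¹(Ω)`. The trace operator is the continuous extension to
`H¹(Ω)` of the restriction `Φ ↦ Φ|_{∂Ω}` of functions that are smooth up to the boundary. -/
def HasTrace (Ω : Set Plane) (φ f : Plane → ℝ) : Prop :=
  MemH1 Ω φ ∧ MemLp f 2 (boundaryMeasure Ω) ∧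
    ∃ Φ : ℕ → Plane → ℝ, (∀ k, ContDiff ℝ ∞ (Φ k)) ∧
      Tendsto (fun k => eLpNorm (φ - Φ k) 2 (volume.restrict Ω)) atTop (𝓝 0) ∧
      Tendsto (fun k => eLpNorm (weakGradient Ω φ - gradient (Φ k)) 2 (volume.restrict Ω))
        atTop (𝓝 0) ∧
      Tendsto (fun k => eLpNorm (f - Φ k) 2 (boundaryMeasure Ω)) atTop (𝓝 0)

/-- `φ ∈ H¹(Ω)` with `Δ φ = 0` in `Ω` in the weak sense. -/
def IsHarmonicH1 (Ω : Set Plane) (φ : Plane → ℝ) : Prop :=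
  MemH1 Ω φ ∧ ∀ ψ, IsTestFunction Ω ψ → ∫ x in Ω, ⟪weakGradient Ω φ x, gradient ψ x⟫ = 0

/-- `u ∈ H¹(Ω)` solves `Δ u = 0` in `Ω`, `u = g` on `∂Ω`. -/
def SolvesDirichlet (Ω : Set Plane) (g u : Plane → ℝ) : Prop :=
  IsHarmonicH1 Ω u ∧ HasTrace Ω u g

/-! ### Boundary layers and finite elements -/

/-- A conforming triangulation of the set `A` into finitely many nondegenerate closed triangles,
given by their vertex sets; two triangles meet in the convex hull of their common vertices. -/
structure IsTriangulation (A : Set Plane) (T : Finset (Finset Plane)) : Prop where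
  card_eq : ∀ t ∈ T, t.card = 3
  indep : ∀ t ∈ T, AffineIndependent ℝ ((↑) : t → Plane)
  covers : (⋃ t ∈ T, convexHull ℝ (t : Set Plane)) = A
  conforming : ∀ s ∈ T, ∀ t ∈ T,
    convexHull ℝ (s : Set Plane) ∩ convexHull ℝ (t : Set Plane) =
      convexHull ℝ ((s : Set Plane) ∩ (t : Set Plane))

/-- `S ⊆ Ω` is a boundary layer of `Ω` with conforming triangulation `T`. -/
structure IsBoundaryLayer (Ω S : Set Plane) (T : Finset (Finset Plane)) : Prop where
  subset : S ⊆ Ω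
  lipschitz : IsLipschitzDomain S
  frontier_subset : frontier Ω ⊆ frontier S
  triangulation : IsTriangulation (closure S) T

/-- The interior part `Γᶜ = ∂S \ ∂Ω` of the boundary of a boundary layer `S`. -/
def innerBoundary (Ω S : Set Plane) : Set Plane := frontier S \ frontier Ω

/-- The Lagrange finite element space of degree `p` on `S` with zero values on `Γᶜ`: functions
that are continuous on `closure S`, polynomial of total degree at most `p` on each triangle, and
zero on `Γᶜ`. A function on `closure S` is represented by its extension by zero to the plane. -/
structure MemFEM (p : ℕ) (Ω S : Set Plane) (T : Finset (Finset Plane)) (φ : Plane → ℝ) :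
    Prop where
  continuousOn : ContinuousOn φ (closure S)
  polynomial : ∀ t ∈ T, ∃ P : MvPolynomial (Fin 2) ℝ, P.totalDegree ≤ p ∧
    ∀ x ∈ convexHull ℝ (t : Set Plane), φ x = MvPolynomial.eval (fun i => x i) P
  zero_inner : ∀ x ∈ innerBoundary Ω S, φ x = 0
  zero_outside : ∀ x, x ∉ closure S → φ x = 0

/-- The gradient of a finite element function on `closure S`. It is the classical gradient in the
interior of each triangle, and the one-sided gradient, taken from inside `S`, at all points of
`∂S` other than vertices of the triangulation. -/
def femGradient (S : Set Plane) (φ : Plane → ℝ) (x : Plane) : Plane :=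
  gradientWithin φ (closure S) x

/-- The vectorial curl `(-∂₂ φ, ∂₁ φ)` of a finite element function on `closure S`. -/
def femCurl (S : Set Plane) (φ : Plane → ℝ) (x : Plane) : Plane :=
  !₂[-(femGradient S φ x 1), femGradient S φ x 0]

/-- The scalar product `(f, n · curl φ)` in `L²(∂Ω)`. -/
def boundaryForm (Ω S : Set Plane) (f φ : Plane → ℝ) : ℝ :=
  ∫ x, f x * ⟪exteriorNormal Ω x, femCurl S φ x⟫ ∂(boundaryMeasure Ω)

/-- `w` belongs to the finite element space and
`(∇ w, ∇ φ)_{L²(S)} = (f, n · curl φ)_{L²(∂Ω)}` for all `φ` in the finite element space. -/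
def SolvesDiscrete (p : ℕ) (Ω S : Set Plane) (T : Finset (Finset Plane)) (f w : Plane → ℝ) :
    Prop :=
  MemFEM p Ω S T w ∧ ∀ φ, MemFEM p Ω S T φ →
    ∫ x in S, ⟪femGradient S w x, femGradient S φ x⟫ = boundaryForm Ω S f φ

end

end BoundaryLayer

open BoundaryLayer

/-!
On each triangle the divergence theorem turns the boundary integral of `f (n · curl φ)`, `f` smooth,
into the integral of `⟪∇f, curl φ⟫`. Summed over the triangulation, the interior edges cancel, since
the tangential derivative of the continuous `φ` is the same from both sides, and the edges on `Γᶜ`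
contribute nothing, since `φ = 0` there. Approximating `u ∈ H¹(Ω)` by smooth functions yields
`(f, n · curl φ)_Γ = (∇u, curl φ)_S = (F, ∇φ)_S` for the trace `f` of `u`, with `F = -rot ∇u`. The
discrete problem thus asks for the orthogonal projection of `F` onto a finite-dimensional space of
gradients in `L²(S)`, and the estimate is `2 (F, ψ)_S - ‖ψ‖² ≤ ‖F‖² = ‖∇u‖²_S ≤ ‖∇u‖²_Ω`, applied
with `u - v` in place of `u`.
-/

namespace BoundaryLayer

noncomputable section

/-! ### Rotation by a right angle -/

instance : Fact (Module.finrank ℝ Plane = 2) := ⟨finrank_euclideanSpace_fin⟩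

/-- The orientation of the plane given by the standard basis. -/
abbrev planeOrientation : Orientation ℝ Plane (Fin 2) :=
  (EuclideanSpace.basisFun (Fin 2) ℝ).toBasis.orientation

/-- Counterclockwise rotation by a right angle, so that `curl φ = rot (∇ φ)`. The cross product
`a₀ b₁ - a₁ b₀` is written `⟪rot a, b⟫`. -/
def rot : Plane ≃ₗᵢ[ℝ] Plane := planeOrientation.rightAngleRotation

lemma inner_rot_left (a b : Plane) : ⟪rot a, b⟫ = a 0 * b 1 - a 1 * b 0 := by
  rw [rot, Orientation.inner_rightAngleRotation_left, Orientation.areaForm_to_volumeForm,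
    planeOrientation.volumeForm_robust (EuclideanSpace.basisFun (Fin 2) ℝ) rfl,
    Module.Basis.det_apply, Matrix.det_fin_two]
  simp only [Module.Basis.toMatrix_apply, OrthonormalBasis.coe_toBasis_repr_apply,
    EuclideanSpace.basisFun_repr, Matrix.cons_val_zero, Matrix.cons_val_one]
  ring

lemma inner_rot_swap (a b : Plane) : ⟪rot a, b⟫ = -⟪rot b, a⟫ := by
  rw [inner_rot_left, inner_rot_left]
  ring

lemma inner_rot_right (a b : Plane) : ⟪a, rot b⟫ = -⟪rot a, b⟫ := by
  rw [real_inner_comm, inner_rot_swap]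

lemma inner_rot_self (a : Plane) : ⟪rot a, a⟫ = 0 := by
  rw [inner_rot_left]
  ring

lemma rot_eq (a : Plane) : rot a = !₂[-(a 1), a 0] := by
  refine ext_inner_right ℝ fun b => ?_
  rw [inner_rot_left]
  simp only [PiLp.inner_apply, RCLike.inner_apply, Real.ringHom_apply, Fin.sum_univ_two,
    Matrix.cons_val_zero, Matrix.cons_val_one]
  ring

/-! ### Barycentric coordinates -/

/-- `t` is the vertex set of a nondegenerate triangle. -/
structure IsTriangle (t : Finset Plane) : Prop where
  card_eq : t.card = 3
  indep : AffineIndependent ℝ ((↑) : t → Plane)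

/-- The vertices of a triangle as an affine basis of the plane. -/
def IsTriangle.basis {t : Finset Plane} (h : IsTriangle t) : AffineBasis t ℝ Plane :=
  ⟨(↑), h.indep, by
    rw [h.indep.affineSpan_eq_top_iff_card_eq_finrank_add_one]
    simp [h.card_eq]⟩

open Classical in
/-- The barycentric coordinate of the triangle `t` belonging to the vertex `c` (value `0` if `t` is
degenerate or `c` is not a vertex). -/
def bary (t : Finset Plane) (c : Plane) : Plane →ᵃ[ℝ] ℝ :=
  if h : IsTriangle t ∧ c ∈ t then h.1.basis.coord ⟨c, h.2⟩ else 0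

/-- The gradient of a barycentric coordinate. -/
def baryGrad (t : Finset Plane) (c : Plane) : Plane :=
  (InnerProductSpace.toDual ℝ Plane).symm (LinearMap.toContinuousLinearMap (bary t c).linear)

/-- The exterior unit normal of the triangle `t` on the edge opposite to the vertex `c`. -/
def edgeNormal (t : Finset Plane) (c : Plane) : Plane := -(‖baryGrad t c‖⁻¹ • baryGrad t c)

/-- The closed edge of the triangle `t` opposite to the vertex `c`. -/
def edge (t : Finset Plane) (c : Plane) : Set Plane :=
  {x | x ∈ convexHull ℝ (t : Set Plane) ∧ bary t c x = 0}

section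

variable {t s : Finset Plane} {a b c d x : Plane}

lemma continuous_bary (t : Finset Plane) (c : Plane) : Continuous (bary t c) :=
  (bary t c).continuous_of_finiteDimensional

lemma bary_sub (t : Finset Plane) (c x y : Plane) :
    bary t c x - bary t c y = ⟪baryGrad t c, x - y⟫ := by
  simpa [baryGrad] using ((bary t c).linearMap_vsub x y).symm

lemma isCompact_triangle (t : Finset Plane) : IsCompact (convexHull ℝ (t : Set Plane)) :=
  t.finite_toSet.isCompact_convexHull ℝ

lemma isCompact_edge (t : Finset Plane) (c : Plane) : IsCompact (edge t c) :=
  (isCompact_triangle t).inter_right (isClosed_eq (continuous_bary t c) continuous_const)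

namespace IsTriangle

lemma range_basis (h : IsTriangle t) : Set.range h.basis = (t : Set Plane) := by
  change Set.range ((↑) : t → Plane) = _
  simp

lemma bary_eq (h : IsTriangle t) (hc : c ∈ t) : bary t c = h.basis.coord ⟨c, hc⟩ := by
  rw [bary, dif_pos ⟨h, hc⟩]

lemma bary_self (h : IsTriangle t) (hc : c ∈ t) : bary t c c = 1 := by
  rw [h.bary_eq hc]
  exact h.basis.coord_apply_eq ⟨c, hc⟩

lemma bary_of_ne (h : IsTriangle t) (hc : c ∈ t) (hd : d ∈ t) (hcd : c ≠ d) :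
    bary t c d = 0 := by
  rw [h.bary_eq hc]
  exact h.basis.coord_apply_ne (i := ⟨c, hc⟩) (j := ⟨d, hd⟩) (by simpa using hcd)

lemma mem_convexHull_iff (h : IsTriangle t) :
    x ∈ convexHull ℝ (t : Set Plane) ↔ ∀ c ∈ t, 0 ≤ bary t c x := by
  rw [← h.range_basis, h.basis.convexHull_eq_nonneg_coord]
  exact ⟨fun H c hc => h.bary_eq hc ▸ H ⟨c, hc⟩, fun H c => h.bary_eq c.2 ▸ H c c.2⟩

lemma mem_interior_iff (h : IsTriangle t) :
    x ∈ interior (convexHull ℝ (t : Set Plane)) ↔ ∀ c ∈ t, 0 < bary t c x := by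
  rw [← h.range_basis, h.basis.interior_convexHull]
  exact ⟨fun H c hc => h.bary_eq hc ▸ H ⟨c, hc⟩, fun H c => h.bary_eq c.2 ▸ H c c.2⟩

lemma interior_nonempty (h : IsTriangle t) :
    (interior (convexHull ℝ (t : Set Plane))).Nonempty := by
  rw [interior_convexHull_nonempty_iff_affineSpan_eq_top, ← h.range_basis]
  exact h.basis.tot

lemma sum_bary (h : IsTriangle t) (x : Plane) : ∑ c ∈ t, bary t c x = 1 := by
  rw [← h.basis.sum_coord_apply_eq_one x, ← Finset.sum_coe_sort]
  exact Finset.sum_congr rfl fun c _ => by rw [h.bary_eq c.2]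

lemma sum_bary_smul (h : IsTriangle t) (x : Plane) : ∑ c ∈ t, bary t c x • c = x := by
  conv_rhs => rw [← h.basis.linear_combination_coord_eq_self x]
  rw [← Finset.sum_coe_sort]
  exact Finset.sum_congr rfl fun c _ => by rw [h.bary_eq c.2]; rfl

lemma affineMap_apply (h : IsTriangle t) (f : Plane →ᵃ[ℝ] ℝ) (x : Plane) :
    f x = ∑ c ∈ t, bary t c x * f c := by
  have hf : ∀ y, f y = f.linear y + f 0 := congrFun f.decomp
  calc f x = f.linear (∑ c ∈ t, bary t c x • c) + (∑ c ∈ t, bary t c x) * f 0 := by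
        rw [hf x, h.sum_bary_smul, h.sum_bary, one_mul]
    _ = ∑ c ∈ t, bary t c x * f c := by
        simp only [map_sum, map_smul, smul_eq_mul, Finset.sum_mul, ← Finset.sum_add_distrib,
          ← mul_add, ← hf]

lemma baryGrad_ne_zero (h : IsTriangle t) (hc : c ∈ t) : baryGrad t c ≠ 0 := by
  intro h0
  obtain ⟨d, hd, hdc⟩ := Finset.exists_mem_ne (by rw [h.card_eq]; norm_num) c
  have := bary_sub t c c d
  rw [h.bary_self hc, h.bary_of_ne hc hd hdc.symm, h0, inner_zero_left] at this
  norm_num at this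

lemma norm_edgeNormal (h : IsTriangle t) (hc : c ∈ t) : ‖edgeNormal t c‖ = 1 := by
  rw [edgeNormal, norm_neg, norm_smul, norm_inv, norm_norm,
    inv_mul_cancel₀ (norm_ne_zero_iff.2 (h.baryGrad_ne_zero hc))]

lemma norm_smul_edgeNormal (h : IsTriangle t) (hc : c ∈ t) :
    ‖baryGrad t c‖ • edgeNormal t c = -baryGrad t c := by
  rw [edgeNormal, smul_neg, smul_inv_smul₀ (norm_ne_zero_iff.2 (h.baryGrad_ne_zero hc))]

lemma isOpenMap_bary (h : IsTriangle t) (hc : c ∈ t) : IsOpenMap (bary t c) := by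
  have : Nontrivial t := Fintype.one_lt_card_iff_nontrivial.1 (by simp [h.card_eq])
  rw [h.bary_eq hc]
  exact isOpenMap_barycentric_coord h.basis ⟨c, hc⟩

lemma frequently_bary_pos (h : IsTriangle t) (hc : c ∈ t) (hx : bary t c x = 0) :
    ∃ᶠ y in 𝓝 x, 0 < bary t c y :=
  frequently_map.1 <| (frequently_gt_nhds 0).filter_mono (hx ▸ (h.isOpenMap_bary hc).nhds_le x)

lemma frequently_bary_neg (h : IsTriangle t) (hc : c ∈ t) (hx : bary t c x = 0) :
    ∃ᶠ y in 𝓝 x, bary t c y < 0 :=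
  frequently_map.1 <| (frequently_lt_nhds 0).filter_mono (hx ▸ (h.isOpenMap_bary hc).nhds_le x)

lemma mem_face (h : IsTriangle t) (hst : s ⊆ t) (hx : x ∈ convexHull ℝ (t : Set Plane))
    (hx0 : ∀ c ∈ t, c ∉ s → bary t c x = 0) : x ∈ convexHull ℝ (s : Set Plane) := by
  have hsum : ∑ c ∈ s, bary t c x = 1 := by
    rw [Finset.sum_subset hst hx0, h.sum_bary]
  have hsmul : ∑ c ∈ s, bary t c x • c = x := by
    rw [Finset.sum_subset hst fun c hc hcs => by rw [hx0 c hc hcs, zero_smul], h.sum_bary_smul]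
  rw [← hsmul]
  exact (convex_convexHull ℝ _).sum_mem (fun c hc => h.mem_convexHull_iff.1 hx c (hst hc)) hsum
    fun c hc => subset_convexHull ℝ _ hc

lemma edge_eq (h : IsTriangle t) (hc : c ∈ t) :
    edge t c = convexHull ℝ ((t.erase c : Finset Plane) : Set Plane) := by
  refine Set.Subset.antisymm ?_ ?_
  · rintro x ⟨hx, hx0⟩
    refine h.mem_face (Finset.erase_subset c t) hx fun d hd hds => ?_
    rwa [show d = c by simpa [hd] using hds]
  · refine convexHull_min (fun d hd => ?_) ?_
    · obtain ⟨hdc, hd⟩ := Finset.mem_erase.1 hd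
      exact ⟨subset_convexHull ℝ _ hd, h.bary_of_ne hc hd hdc.symm⟩
    · exact (convex_convexHull ℝ _).inter ((convex_singleton 0).affine_preimage (bary t c))

lemma ne_of_triple (h : IsTriangle {a, b, c}) : a ≠ b ∧ a ≠ c ∧ b ≠ c := by
  refine ⟨?_, ?_, ?_⟩ <;> rintro rfl <;> refine absurd h.card_eq (ne_of_lt ?_) <;>
    simpa using Nat.lt_succ_of_le Finset.card_le_two

end IsTriangle

end

/-! ### The divergence theorem on a triangle -/

section

variable {E F : Type*} [NormedAddCommGroup E] [NormedSpace ℝ E] [MeasurableSpace E] [BorelSpace E]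
  [NormedAddCommGroup F] [NormedSpace ℝ F]

lemma setIntegral_segment (a b : E) (f : E → F) :
    ∫ x in segment ℝ a b, f x ∂(Measure.hausdorffMeasure 1) =
      ‖b - a‖ • ∫ τ in (0 : ℝ)..1, f (AffineMap.lineMap a b τ) := by
  rcases eq_or_ne a b with rfl | hab
  · have : (Measure.hausdorffMeasure 1 : Measure E) {a} = 0 := by
      simpa using hausdorffMeasure_segment a a
    simp [segment_same, Measure.restrict_eq_zero.2 this]
  have hemb : MeasurableEmbedding (AffineMap.lineMap a b : ℝ → E) :=
    ((antilipschitzWith_lineMap hab).isClosedEmbedding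
      (lipschitzWith_lineMap a b).uniformContinuous).measurableEmbedding
  have hcomap : (Measure.hausdorffMeasure 1 : Measure E).comap (AffineMap.lineMap a b) =
      nndist a b • (volume : Measure ℝ) := by
    ext s _
    rw [hemb.comap_apply, hausdorffMeasure_lineMap_image, hausdorffMeasure_real]
    rfl
  rw [segment_eq_image_lineMap, ← Measure.restrict_restrict_of_subset (Set.image_subset_range _ _),
    ← hemb.map_comap, hemb.setIntegral_map, Set.preimage_image_eq _ hemb.injective, hcomap,
    Measure.restrict_smul, integral_smul_nnreal_measure, integral_Icc_eq_integral_Ioc,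
    ← intervalIntegral.integral_of_le zero_le_one, NNReal.smul_def, coe_nndist, dist_comm,
    dist_eq_norm]

end

/-- The triangle in `ℝ × ℝ` with vertices `(0, 0)`, `(1, 0)` and `(0, 1)`. -/
def refTriangle : Set (ℝ × ℝ) := {p | 0 ≤ p.1 ∧ 0 ≤ p.2 ∧ p.1 + p.2 ≤ 1}

lemma isCompact_refTriangle : IsCompact refTriangle := by
  refine (isCompact_Icc (a := ((0 : ℝ), (0 : ℝ))) (b := (1, 1))).of_isClosed_subset ?_ ?_
  · exact (isClosed_le continuous_const continuous_fst).inter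
      ((isClosed_le continuous_const continuous_snd).inter
        (isClosed_le (continuous_fst.add continuous_snd) continuous_const))
  · rintro ⟨s, r⟩ ⟨hs : 0 ≤ s, hr : 0 ≤ r, hsr : s + r ≤ 1⟩
    exact ⟨⟨hs, hr⟩, ⟨show s ≤ 1 by linarith, show r ≤ 1 by linarith⟩⟩

lemma setIntegral_refTriangle {h : ℝ × ℝ → ℝ} (hh : Continuous h) :
    ∫ p in refTriangle, h p = ∫ s in (0 : ℝ)..1, ∫ r in (0 : ℝ)..(1 - s), h (s, r) := by
  have hm := isCompact_refTriangle.measurableSet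
  have hi : Integrable (refTriangle.indicator h) (volume.prod volume) :=
    (integrable_indicator_iff hm).2 (hh.continuousOn.integrableOn_compact isCompact_refTriangle)
  have hslice : ∀ s, ∫ r, refTriangle.indicator h (s, r) =
      (Set.Icc (0 : ℝ) 1).indicator (fun s => ∫ r in (0 : ℝ)..(1 - s), h (s, r)) s := by
    intro s
    have hsec : (fun r => refTriangle.indicator h (s, r)) =
        {r | 0 ≤ s ∧ 0 ≤ r ∧ s + r ≤ 1}.indicator fun r => h (s, r) := rfl
    by_cases hs : s ∈ Set.Icc (0 : ℝ) 1
    · have : {r | 0 ≤ s ∧ 0 ≤ r ∧ s + r ≤ 1} = Set.Icc 0 (1 - s) := by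
        ext r
        simp only [Set.mem_ofPred_eq, Set.mem_Icc, hs.1, true_and, le_sub_iff_add_le']
      rw [hsec, this, integral_indicator measurableSet_Icc, Set.indicator_of_mem hs,
        integral_Icc_eq_integral_Ioc, intervalIntegral.integral_of_le (sub_nonneg.2 hs.2)]
    · have : {r | 0 ≤ s ∧ 0 ≤ r ∧ s + r ≤ 1} = ∅ :=
        Set.eq_empty_of_forall_notMem fun r hr => hs ⟨hr.1, by linarith [hr.2.1, hr.2.2]⟩
      rw [hsec, this, Set.indicator_empty, Set.indicator_of_notMem hs, integral_zero]
  rw [← integral_indicator hm, Measure.volume_eq_prod, integral_prod _ hi]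
  simp only [hslice]
  rw [integral_indicator measurableSet_Icc, integral_Icc_eq_integral_Ioc,
    intervalIntegral.integral_of_le zero_le_one]

lemma setIntegral_refTriangle_swap (h : ℝ × ℝ → ℝ) :
    ∫ p in refTriangle, h p.swap = ∫ p in refTriangle, h p := by
  have hpre : Prod.swap ⁻¹' refTriangle = refTriangle := by
    ext ⟨s, r⟩
    simp only [refTriangle, Set.mem_preimage, Set.mem_ofPred_eq, Prod.swap_prod_mk, add_comm r s]
    tauto
  simpa only [hpre, ← Measure.volume_eq_prod] using!
    (Measure.measurePreserving_swap (μ := (volume : Measure ℝ))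
      (ν := (volume : Measure ℝ))).setIntegral_preimage_emb
    MeasurableEquiv.prodComm.measurableEmbedding h refTriangle

lemma setIntegral_refTriangle_deriv_snd {G G' : ℝ × ℝ → ℝ} (hG : Continuous G)
    (hG' : Continuous G') (dG : ∀ s r, HasDerivAt (fun r => G (s, r)) (G' (s, r)) r) :
    ∫ p in refTriangle, G' p =
      (∫ s in (0 : ℝ)..1, G (s, 1 - s)) - ∫ s in (0 : ℝ)..1, G (s, 0) := by
  have hFTC : ∀ s, ∫ r in (0 : ℝ)..(1 - s), G' (s, r) = G (s, 1 - s) - G (s, 0) := fun s =>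
    intervalIntegral.integral_eq_sub_of_hasDerivAt (fun r _ => dG s r)
      (Continuous.intervalIntegrable (by fun_prop) _ _)
  rw [setIntegral_refTriangle hG', ← intervalIntegral.integral_sub
    (Continuous.intervalIntegrable (by fun_prop) _ _)
    (Continuous.intervalIntegrable (by fun_prop) _ _)]
  simp only [hFTC]

lemma setIntegral_refTriangle_deriv_fst {F F' : ℝ × ℝ → ℝ} (hF : Continuous F)
    (hF' : Continuous F') (dF : ∀ s r, HasDerivAt (fun s => F (s, r)) (F' (s, r)) s) :
    ∫ p in refTriangle, F' p =
      (∫ r in (0 : ℝ)..1, F (1 - r, r)) - ∫ r in (0 : ℝ)..1, F (0, r) := by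
  rw [← setIntegral_refTriangle_swap]
  exact setIntegral_refTriangle_deriv_snd (hF.comp continuous_swap) (hF'.comp continuous_swap)
    fun r s => dF s r

/-- The affine parametrisation over `refTriangle` of the triangle with vertices `a`, `b`, `c`. -/
def triParam (a b c : Plane) (p : ℝ × ℝ) : Plane := a + (p.1 • (b - a) + p.2 • (c - a))

section

variable {a b c : Plane}

lemma continuous_triParam (a b c : Plane) : Continuous (triParam a b c) := by
  unfold triParam
  fun_prop

lemma hasDerivAt_triParam_fst (a b c : Plane) (s r : ℝ) :
    HasDerivAt (fun s => triParam a b c (s, r)) (b - a) s := by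
  simpa [triParam] using
    (((hasDerivAt_id s).smul_const (b - a)).add_const (r • (c - a))).const_add a

lemma hasDerivAt_triParam_snd (a b c : Plane) (s r : ℝ) :
    HasDerivAt (fun r => triParam a b c (s, r)) (c - a) r := by
  simpa [triParam] using
    (((hasDerivAt_id r).smul_const (c - a)).const_add (s • (b - a))).const_add a

lemma triParam_zero_left (a b c : Plane) (r : ℝ) :
    triParam a b c (0, r) = AffineMap.lineMap a c r := by
  simp only [triParam, AffineMap.lineMap_apply, vsub_eq_sub, vadd_eq_add]
  module

lemma triParam_zero_right (a b c : Plane) (s : ℝ) :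
    triParam a b c (s, 0) = AffineMap.lineMap a b s := by
  simp only [triParam, AffineMap.lineMap_apply, vsub_eq_sub, vadd_eq_add]
  module

lemma triParam_hypotenuse (a b c : Plane) (r : ℝ) :
    triParam a b c (1 - r, r) = AffineMap.lineMap b c r := by
  simp only [triParam, AffineMap.lineMap_apply, vsub_eq_sub, vadd_eq_add]
  module

lemma convex_refTriangle : Convex ℝ refTriangle := by
  rintro ⟨s, r⟩ ⟨hs, hr, hsr⟩ ⟨s', r'⟩ ⟨hs', hr', hsr'⟩ α β hα hβ hαβ
  simp only at hs hr hsr hs' hr' hsr'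
  refine ⟨?_, ?_, ?_⟩ <;>
    simp only [Prod.smul_mk, Prod.mk_add_mk, smul_eq_mul]
  · positivity
  · positivity
  · nlinarith

lemma convexHull_eq_image_triParam (a b c : Plane) :
    convexHull ℝ {a, b, c} = triParam a b c '' refTriangle := by
  refine Set.Subset.antisymm (convexHull_min ?_ ?_) ?_
  · have h0 : triParam a b c (0, 0) = a := by simp [triParam]
    have h1 : triParam a b c (1, 0) = b := by simp [triParam]
    have h2 : triParam a b c (0, 1) = c := by simp [triParam]
    rintro x (rfl | rfl | rfl)
    · exact ⟨_, by norm_num [refTriangle], h0⟩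
    · exact ⟨_, by norm_num [refTriangle], h1⟩
    · exact ⟨_, by norm_num [refTriangle], h2⟩
  · rintro _ ⟨p, hp, rfl⟩ _ ⟨q, hq, rfl⟩ α β hα hβ hαβ
    refine ⟨_, convex_refTriangle hp hq hα hβ hαβ, ?_⟩
    obtain rfl : β = 1 - α := eq_sub_of_add_eq' hαβ
    simp only [triParam, Prod.fst_add, Prod.snd_add, Prod.smul_fst, Prod.smul_snd, smul_eq_mul]
    module
  · rintro _ ⟨⟨s, r⟩, ⟨hs, hr, hsr⟩, rfl⟩
    have hsum : triParam a b c (s, r) =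
        ∑ i, (![1 - s - r, s, r] : Fin 3 → ℝ) i • (![a, b, c] : Fin 3 → Plane) i := by
      simp only [triParam, Fin.sum_univ_three, Matrix.cons_val]
      module
    rw [hsum]
    refine (convex_convexHull ℝ _).sum_mem (fun i _ => ?_) ?_ fun i _ => subset_convexHull ℝ _ ?_
    · fin_cases i
      exacts [by simpa [sub_sub] using hsr, hs, hr]
    · simp only [Fin.sum_univ_three, Matrix.cons_val]
      ring
    · fin_cases i <;> simp

/-- The linear map of the plane with columns `u` and `w`. -/
def ofColumns (u w : Plane) : Plane →L[ℝ] Plane :=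
  (EuclideanSpace.proj 0).smulRight u + (EuclideanSpace.proj 1).smulRight w

lemma det_ofColumns (u w : Plane) : (ofColumns u w).det = ⟪rot u, w⟫ := by
  rw [ContinuousLinearMap.det,
    ← LinearMap.det_toMatrix (EuclideanSpace.basisFun (Fin 2) ℝ).toBasis, Matrix.det_fin_two,
    inner_rot_left]
  simp [LinearMap.toMatrix_apply, ofColumns, mul_comm]

/-- The coordinates of the plane as a measurable equivalence. -/
def coords : Plane ≃ᵐ ℝ × ℝ :=
  (MeasurableEquiv.toLp 2 (Fin 2 → ℝ)).symm.trans MeasurableEquiv.finTwoArrow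

lemma measurePreserving_coords : MeasurePreserving coords :=
  (volume_preserving_finTwoArrow ℝ).comp
    (EuclideanSpace.volume_preserving_symm_measurableEquiv_toLp (Fin 2))

lemma triParam_coords (a b c y : Plane) :
    triParam a b c (coords y) = a + ofColumns (b - a) (c - a) y := rfl

lemma setIntegral_convexHull_triple (hD : ⟪rot (b - a), c - a⟫ ≠ 0) (f : Plane → ℝ) :
    ∫ x in convexHull ℝ {a, b, c}, f x =
      |⟪rot (b - a), c - a⟫| * ∫ p in refTriangle, f (triParam a b c p) := by
  set A := ofColumns (b - a) (c - a)
  have hdet : A.det = ⟪rot (b - a), c - a⟫ := det_ofColumns _ _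
  have hinj : Function.Injective A :=
    ((Module.End.isUnit_iff (A : Plane →ₗ[ℝ] Plane)).1
      ((LinearMap.isUnit_iff_isUnit_det _).2 (show IsUnit A.det from hdet ▸ hD.isUnit))).1
  have himg : convexHull ℝ {a, b, c} = (fun y => a + A y) '' (coords ⁻¹' refTriangle) := by
    rw [convexHull_eq_image_triParam, ← coords.image_symm, Set.image_image]
    simp only [A, ← triParam_coords, MeasurableEquiv.apply_symm_apply]
  rw [himg, integral_image_eq_integral_abs_det_fderiv_smul (f' := fun _ => A) volume
    (coords.measurable isCompact_refTriangle.measurableSet)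
    (fun y _ => (A.hasFDerivAt.const_add a).hasFDerivWithinAt)
    (fun y _ z _ hyz => hinj (add_left_cancel hyz))]
  simp only [hdet, smul_eq_mul, integral_const_mul, A, ← triParam_coords]
  rw [measurePreserving_coords.setIntegral_preimage_emb coords.measurableEmbedding
    (fun p => f (triParam a b c p))]

/-- The divergence of a vector field. -/
def divergence (V : Plane → Plane) (x : Plane) : ℝ := LinearMap.trace ℝ Plane (fderiv ℝ V x)

lemma inner_rot_map_add (L : Plane →L[ℝ] Plane) (u w : Plane) :
    ⟪rot (L u), w⟫ + ⟪rot u, L w⟫ = LinearMap.trace ℝ Plane L * ⟪rot u, w⟫ := by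
  have hL : ∀ v i, L v i = v 0 * L (EuclideanSpace.single 0 1) i +
      v 1 * L (EuclideanSpace.single 1 1) i := fun v i => by
    conv_lhs => rw [← (EuclideanSpace.basisFun (Fin 2) ℝ).sum_repr v]
    simp [Fin.sum_univ_two]
  have htrace : LinearMap.trace ℝ Plane L =
      L (EuclideanSpace.single 0 1) 0 + L (EuclideanSpace.single 1 1) 1 := by
    rw [LinearMap.trace_eq_sum_inner _ (EuclideanSpace.basisFun (Fin 2) ℝ)]
    simp [Fin.sum_univ_two, EuclideanSpace.inner_single_left]
  simp only [inner_rot_left, hL u, hL w, htrace]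
  ring

/-- The flux of `V` through the segment from `a` to `b`, from left to right. -/
def segmentFlux (V : Plane → Plane) (a b : Plane) : ℝ :=
  ∫ τ in (0 : ℝ)..1, ⟪rot (V (AffineMap.lineMap a b τ)), b - a⟫

lemma segmentFlux_swap (V : Plane → Plane) (a b : Plane) :
    segmentFlux V b a = -segmentFlux V a b := by
  have h := intervalIntegral.integral_comp_sub_left (a := 0) (b := 1)
    (fun τ => ⟪rot (V (AffineMap.lineMap a b τ)), b - a⟫) 1
  simp only [AffineMap.lineMap_apply_one_sub, sub_self, sub_zero] at h
  rw [segmentFlux, segmentFlux, ← h, ← intervalIntegral.integral_neg]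
  simp only [← inner_neg_right, neg_sub]

lemma hasDerivAt_inner_rot_comp {V : Plane → Plane} (hV : Differentiable ℝ V) {γ : ℝ → Plane}
    {v : Plane} {τ : ℝ} (hγ : HasDerivAt γ v τ) (w : Plane) :
    HasDerivAt (fun τ => ⟪rot (V (γ τ)), w⟫) ⟪rot (fderiv ℝ V (γ τ) v), w⟫ τ := by
  have hVγ := (hV (γ τ)).hasFDerivAt.comp_hasDerivAt τ hγ
  simpa using (rot.toContinuousLinearEquiv.hasFDerivAt.comp_hasDerivAt τ hVγ).inner ℝ
    (hasDerivAt_const τ w)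

lemma setIntegral_refTriangle_divergence (a b c : Plane) {V : Plane → Plane}
    (hV : ContDiff ℝ 1 V) :
    ⟪rot (b - a), c - a⟫ * ∫ p in refTriangle, divergence V (triParam a b c p) =
      segmentFlux V a b + segmentFlux V b c + segmentFlux V c a := by
  set ψ := triParam a b c
  have hψ : Continuous ψ := continuous_triParam a b c
  have hV₀ : Continuous V := hV.continuous
  have hd := hV.differentiable one_ne_zero
  have hF := setIntegral_refTriangle_deriv_fst (F := fun p => ⟪rot (V (ψ p)), c - a⟫)
    (F' := fun p => ⟪rot (fderiv ℝ V (ψ p) (b - a)), c - a⟫) (by fun_prop) (by fun_prop)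
    fun s r => hasDerivAt_inner_rot_comp hd (hasDerivAt_triParam_fst a b c s r) _
  have hG := setIntegral_refTriangle_deriv_snd (G := fun p => ⟪rot (V (ψ p)), b - a⟫)
    (G' := fun p => ⟪rot (fderiv ℝ V (ψ p) (c - a)), b - a⟫) (by fun_prop) (by fun_prop)
    fun s r => hasDerivAt_inner_rot_comp hd (hasDerivAt_triParam_snd a b c s r) _
  have hreflect : ∫ s in (0 : ℝ)..1, ⟪rot (V (ψ (s, 1 - s))), b - a⟫ =
      ∫ r in (0 : ℝ)..1, ⟪rot (V (ψ (1 - r, r))), b - a⟫ := by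
    simpa using intervalIntegral.integral_comp_sub_left (a := 0) (b := 1)
      (fun r => ⟪rot (V (ψ (1 - r, r))), b - a⟫) 1
  have hbc : segmentFlux V b c = (∫ r in (0 : ℝ)..1, ⟪rot (V (ψ (1 - r, r))), c - a⟫) -
      ∫ r in (0 : ℝ)..1, ⟪rot (V (ψ (1 - r, r))), b - a⟫ := by
    rw [← intervalIntegral.integral_sub (Continuous.intervalIntegrable (by fun_prop) _ _)
      (Continuous.intervalIntegrable (by fun_prop) _ _)]
    simp only [← inner_sub_right, sub_sub_sub_cancel_right, ψ, triParam_hypotenuse, segmentFlux]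
  have hac : segmentFlux V a c = ∫ r in (0 : ℝ)..1, ⟪rot (V (ψ (0, r))), c - a⟫ := by
    simp only [ψ, triParam_zero_left, segmentFlux]
  have hab : segmentFlux V a b = ∫ s in (0 : ℝ)..1, ⟪rot (V (ψ (s, 0))), b - a⟫ := by
    simp only [ψ, triParam_zero_right, segmentFlux]
  have hint : ∀ {g : ℝ × ℝ → ℝ}, Continuous g → IntegrableOn g refTriangle := fun hg =>
    hg.continuousOn.integrableOn_compact isCompact_refTriangle
  have hdiv : ∀ p, ⟪rot (b - a), c - a⟫ * divergence V (ψ p) =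
      ⟪rot (fderiv ℝ V (ψ p) (b - a)), c - a⟫ - ⟪rot (fderiv ℝ V (ψ p) (c - a)), b - a⟫ :=
    fun p => by
      rw [divergence, mul_comm, ← inner_rot_map_add, inner_rot_swap (b - a), ← sub_eq_add_neg]
  simp only [← integral_const_mul, hdiv]
  rw [integral_sub (hint (by fun_prop)) (hint (by fun_prop)), hF, hG, hreflect,
    segmentFlux_swap V a c, hbc, hac, hab]
  ring

lemma inner_rot_smul (u w g : Plane) : ⟪rot u, w⟫ • g = ⟪g, w⟫ • rot u - ⟪g, u⟫ • rot w := by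
  refine ext_inner_right ℝ fun x => ?_
  simp only [inner_sub_left, real_inner_smul_left, inner_rot_left]
  simp only [PiLp.inner_apply, Fin.sum_univ_two, RCLike.inner_apply, conj_trivial]
  ring

lemma IsTriangle.inner_rot_smul_baryGrad (h : IsTriangle {a, b, c}) :
    ⟪rot (b - a), c - a⟫ • baryGrad {a, b, c} c = rot (b - a) := by
  obtain ⟨-, hac, hbc⟩ := h.ne_of_triple
  have ha : bary {a, b, c} c a = 0 := h.bary_of_ne (by simp) (by simp) hac.symm
  have hb : bary {a, b, c} c b = 0 := h.bary_of_ne (by simp) (by simp) hbc.symm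
  have hc : bary {a, b, c} c c = 1 := h.bary_self (by simp)
  rw [inner_rot_smul, ← bary_sub, ← bary_sub, ha, hb, hc]
  simp

lemma IsTriangle.inner_rot_ne_zero (h : IsTriangle {a, b, c}) : ⟪rot (b - a), c - a⟫ ≠ 0 := by
  intro h0
  have hrot : rot (b - a) = 0 := by rw [← h.inner_rot_smul_baryGrad, h0, zero_smul]
  exact h.ne_of_triple.1 (sub_eq_zero.1 ((map_eq_zero_iff rot rot.injective).1 hrot)).symm

lemma IsTriangle.setIntegral_edge (h : IsTriangle {a, b, c}) (V : Plane → Plane) :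
    |⟪rot (b - a), c - a⟫| *
        ∫ x in edge {a, b, c} c, ⟪edgeNormal {a, b, c} c, V x⟫ ∂(Measure.hausdorffMeasure 1) =
      ⟪rot (b - a), c - a⟫ * segmentFlux V a b := by
  have hrot := h.inner_rot_smul_baryGrad
  set D := ⟪rot (b - a), c - a⟫
  have hedge : edge {a, b, c} c = segment ℝ a b := by
    obtain ⟨-, hac, hbc⟩ := h.ne_of_triple
    rw [h.edge_eq (by simp), ← convexHull_pair,
      show ({a, b, c} : Finset Plane).erase c = {a, b} by grind]
    simp
  have hnormal : |D| • ‖b - a‖ • edgeNormal {a, b, c} c = -(D • rot (b - a)) := by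
    have hnorm : ‖b - a‖ = |D| * ‖baryGrad {a, b, c} c‖ := by
      rw [← rot.norm_map, ← hrot, norm_smul, Real.norm_eq_abs]
    rw [hnorm, mul_smul, h.norm_smul_edgeNormal (by simp), ← hrot]
    simp only [smul_neg, smul_smul, abs_mul_abs_self]
  have hflux : ∀ x, |D| * (‖b - a‖ * ⟪edgeNormal {a, b, c} c, V x⟫) = D * ⟪rot (V x), b - a⟫ :=
    fun x => by
      rw [← real_inner_smul_left, ← real_inner_smul_left, hnormal, inner_neg_left,
        real_inner_smul_left, inner_rot_swap (V x), mul_neg]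
  rw [hedge, setIntegral_segment, segmentFlux, smul_eq_mul]
  simp only [← intervalIntegral.integral_const_mul, hflux]

lemma inner_rot_sub_cyclic (a b c : Plane) :
    ⟪rot (c - b), a - b⟫ = ⟪rot (b - a), c - a⟫ := by
  simp only [inner_rot_left, PiLp.sub_apply]
  ring

theorem IsTriangle.setIntegral_divergence {t : Finset Plane} (h : IsTriangle t)
    {V : Plane → Plane} (hV : ContDiff ℝ 1 V) :
    ∫ x in convexHull ℝ (t : Set Plane), divergence V x =
      ∑ c ∈ t, ∫ x in edge t c, ⟪edgeNormal t c, V x⟫ ∂(Measure.hausdorffMeasure 1) := by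
  obtain ⟨a, b, c, hab, hac, hbc, rfl⟩ := Finset.card_eq_three.1 h.card_eq
  have hbca : ({a, b, c} : Finset Plane) = {b, c, a} := by grind
  have hcab : ({a, b, c} : Finset Plane) = {c, a, b} := by grind
  have hc := h.setIntegral_edge V
  have ha := (hbca ▸ h : IsTriangle {b, c, a}).setIntegral_edge V
  have hb := (hcab ▸ h : IsTriangle {c, a, b}).setIntegral_edge V
  rw [← hbca, inner_rot_sub_cyclic] at ha
  rw [← hcab, inner_rot_sub_cyclic, inner_rot_sub_cyclic] at hb
  refine mul_left_cancel₀ (abs_ne_zero.2 h.inner_rot_ne_zero) ?_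
  rw [Finset.sum_insert (by simp [hab, hac]), Finset.sum_pair hbc, mul_add, mul_add, ha, hb, hc]
  push_cast
  rw [setIntegral_convexHull_triple h.inner_rot_ne_zero, ← mul_assoc, abs_mul_abs_self, mul_assoc,
    setIntegral_refTriangle_divergence a b c hV]
  ring

end

lemma contDiff_gradient {q : Plane → ℝ} (hq : ContDiff ℝ 2 q) : ContDiff ℝ 1 (gradient q) :=
  (InnerProductSpace.toDual ℝ Plane).symm.toContinuousLinearEquiv.contDiff.comp
    (hq.fderiv_right (by norm_num))

lemma inner_fderiv_gradient {q : Plane → ℝ} (hq : ContDiff ℝ 2 q) (x v w : Plane) :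
    ⟪fderiv ℝ (gradient q) x v, w⟫ = fderiv ℝ (fderiv ℝ q) x v w := by
  have hd : DifferentiableAt ℝ (fderiv ℝ q) x :=
    (hq.fderiv_right (m := 1) (by norm_num)).differentiable one_ne_zero x
  have h := (InnerProductSpace.toDual ℝ Plane).symm.toContinuousLinearEquiv.hasFDerivAt.comp x
    hd.hasFDerivAt
  rw [show fderiv ℝ (gradient q) x = _ from h.fderiv]
  simp

lemma trace_rot_comp {A : Plane →L[ℝ] Plane} (hA : ∀ v w, ⟪A v, w⟫ = ⟪A w, v⟫) :
    LinearMap.trace ℝ Plane (rot.toContinuousLinearEquiv.toContinuousLinearMap.comp A) = 0 := by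
  rw [LinearMap.trace_eq_sum_inner _ (EuclideanSpace.basisFun (Fin 2) ℝ), Fin.sum_univ_two]
  have h := hA (EuclideanSpace.single 0 1) (EuclideanSpace.single 1 1)
  change ⟪_, rot (A _)⟫ + ⟪_, rot (A _)⟫ = 0
  simp only [EuclideanSpace.basisFun_apply, inner_rot_right, inner_rot_left,
    EuclideanSpace.inner_single_right, Real.ringHom_apply, PiLp.single_eq_same, ne_eq, one_ne_zero,
    zero_ne_one, not_false_eq_true, PiLp.single_eq_of_ne] at h ⊢
  linarith

lemma divergence_smul_rot_gradient {f q : Plane → ℝ} (hf : Differentiable ℝ f)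
    (hq : ContDiff ℝ 2 q) (x : Plane) :
    divergence (fun x => f x • rot (gradient q x)) x = ⟪gradient f x, rot (gradient q x)⟫ := by
  have hgrad : HasFDerivAt (fun x => rot (gradient q x)) _ x :=
    rot.toContinuousLinearEquiv.hasFDerivAt.comp x
      ((contDiff_gradient hq).differentiable one_ne_zero x).hasFDerivAt
  have hsymm : ∀ v w, ⟪fderiv ℝ (gradient q) x v, w⟫ = ⟪fderiv ℝ (gradient q) x w, v⟫ :=
    fun v w => by
      rw [inner_fderiv_gradient hq, inner_fderiv_gradient hq]
      exact (hq.contDiffAt.isSymmSndFDerivAt (by simp)).eq v w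
  have hV : HasFDerivAt (fun x => f x • rot (gradient q x)) _ x := (hf x).hasFDerivAt.smul hgrad
  have htrace : LinearMap.trace ℝ Plane ((fderiv ℝ f x).smulRight (rot (gradient q x))) =
      fderiv ℝ f x (rot (gradient q x)) := LinearMap.trace_smulRight _ _
  rw [divergence, hV.fderiv, ContinuousLinearMap.toLinearMap_add, map_add,
    ContinuousLinearMap.toLinearMap_smul, map_smul, trace_rot_comp hsymm, htrace,
    smul_zero, zero_add, inner_gradient_left]

theorem IsTriangle.green_rot_gradient {t : Finset Plane} (h : IsTriangle t) {f q : Plane → ℝ}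
    (hf : ContDiff ℝ 1 f) (hq : ContDiff ℝ 2 q) :
    ∫ x in convexHull ℝ (t : Set Plane), ⟪gradient f x, rot (gradient q x)⟫ =
      ∑ c ∈ t, ∫ x in edge t c,
        f x * ⟪edgeNormal t c, rot (gradient q x)⟫ ∂(Measure.hausdorffMeasure 1) := by
  have hV : ContDiff ℝ 1 fun x => f x • rot (gradient q x) :=
    hf.smul (rot.toContinuousLinearEquiv.contDiff.comp (contDiff_gradient hq))
  have := h.setIntegral_divergence hV
  simpa only [divergence_smul_rot_gradient (hf.differentiable one_ne_zero) hq,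
    inner_smul_right] using this

/-! ### Triangulations near a point of an edge -/

section

variable {A : Set Plane} {T : Finset (Finset Plane)} {s t : Finset Plane} {a c d x : Plane}

lemma IsTriangle.bary_eq_zero_of_mem_convexHull_inter (h : IsTriangle t) (hc : c ∈ t)
    (hcs : c ∉ s) (hx : x ∈ convexHull ℝ ((s : Set Plane) ∩ (t : Set Plane))) :
    bary t c x = 0 := by
  have hconv : Convex ℝ {y | bary t c y = 0} :=
    (convex_singleton (𝕜 := ℝ) (0 : ℝ)).affine_preimage (bary t c)
  exact convexHull_min (fun d hd => h.bary_of_ne hc hd.2 fun hcd => hcs (hcd ▸ hd.1)) hconv hx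

lemma IsTriangle.bary_pos_of_mem_edge (h : IsTriangle t) (hc : c ∈ t) (hx : x ∈ edge t c)
    (hxt : x ∉ t) (ha : a ∈ t) (hac : a ≠ c) : 0 < bary t a x := by
  refine lt_of_le_of_ne (h.mem_convexHull_iff.1 hx.1 a ha) fun h0 => hxt ?_
  obtain ⟨b, hb⟩ : ∃ b, (t.erase a).erase c = {b} := by
    rw [← Finset.card_eq_one, Finset.card_erase_of_mem (Finset.mem_erase.2 ⟨hac.symm, hc⟩),
      Finset.card_erase_of_mem ha, h.card_eq]
  have hbt : {b} ⊆ t := hb ▸ (Finset.erase_subset c _).trans (Finset.erase_subset a t)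
  have hxb : x ∈ convexHull ℝ (({b} : Finset Plane) : Set Plane) := by
    refine h.mem_face hbt hx.1 fun v hv hvb => ?_
    by_cases hva : v = a
    · rw [hva, ← h0]
    · rw [show v = c by simpa [← hb, hva, hv] using hvb, hx.2]
  rw [Finset.coe_singleton, convexHull_singleton, Set.mem_singleton_iff] at hxb
  exact hxb ▸ hbt (Finset.mem_singleton_self b)

lemma IsTriangle.eventually_mem_iff (h : IsTriangle t) (hc : c ∈ t) (hx : x ∈ edge t c)
    (hxt : x ∉ t) :
    ∀ᶠ y in 𝓝 x, (y ∈ convexHull ℝ (t : Set Plane) ↔ 0 ≤ bary t c y) ∧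
      (y ∈ interior (convexHull ℝ (t : Set Plane)) ↔ 0 < bary t c y) := by
  have hpos : ∀ᶠ y in 𝓝 x, ∀ a ∈ t.erase c, 0 < bary t a y := by
    rw [Filter.eventually_all_finset]
    intro a ha
    exact (continuous_bary t a).continuousAt.eventually_const_lt
      (h.bary_pos_of_mem_edge hc hx hxt (Finset.mem_of_mem_erase ha) (Finset.ne_of_mem_erase ha))
  filter_upwards [hpos] with y hy
  have hall : ∀ P : Plane → Prop, (∀ a ∈ t, P a) ↔ P c ∧ ∀ a ∈ t.erase c, P a := fun P => by
    rw [← Finset.forall_mem_insert, Finset.insert_erase hc]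
  rw [h.mem_convexHull_iff, h.mem_interior_iff, hall, hall fun a => 0 < bary t a y]
  exact ⟨and_iff_left fun a ha => (hy a ha).le, and_iff_left hy⟩

namespace IsTriangulation

lemma isTriangle (h : IsTriangulation A T) (ht : t ∈ T) : IsTriangle t :=
  ⟨h.card_eq t ht, h.indep t ht⟩

lemma convexHull_subset (h : IsTriangulation A T) (ht : t ∈ T) :
    convexHull ℝ (t : Set Plane) ⊆ A :=
  h.covers ▸ Set.subset_iUnion₂ (s := fun (t : Finset Plane) _ => convexHull ℝ (t : Set Plane)) t ht

lemma exists_mem_notMem (h : IsTriangulation A T) (hs : s ∈ T) (ht : t ∈ T) (hst : s ≠ t) :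
    ∃ c ∈ t, c ∉ s := by
  by_contra! H
  exact hst (Finset.eq_of_subset_of_card_le H (by rw [h.card_eq s hs, h.card_eq t ht])).symm

lemma notMem_of_mem_interior (h : IsTriangulation A T) (hs : s ∈ T) (ht : t ∈ T)
    (hst : s ≠ t) (hx : x ∈ interior (convexHull ℝ (t : Set Plane))) :
    x ∉ convexHull ℝ (s : Set Plane) := by
  intro hxs
  obtain ⟨c, hc, hcs⟩ := h.exists_mem_notMem hs ht hst
  have hxst : x ∈ convexHull ℝ ((s : Set Plane) ∩ (t : Set Plane)) := by
    rw [← h.conforming s hs t ht]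
    exact ⟨hxs, interior_subset hx⟩
  exact ((h.isTriangle ht).mem_interior_iff.1 hx c hc).ne'
    ((h.isTriangle ht).bary_eq_zero_of_mem_convexHull_inter hc hcs hxst)

lemma exists_bary_eq_mul (h : IsTriangulation A T) (hs : s ∈ T) (ht : t ∈ T) (hst : s ≠ t)
    (hc : c ∈ t) (hx : x ∈ edge t c) (hxt : x ∉ t) (hxs : x ∈ convexHull ℝ (s : Set Plane)) :
    ∃ d ∈ s, x ∈ edge s d ∧ ∃ κ, ∀ y, bary s d y = κ * bary t c y := by
  have htri := h.isTriangle ht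
  have hstri := h.isTriangle hs
  have hinter : x ∈ convexHull ℝ ((s : Set Plane) ∩ (t : Set Plane)) := by
    rw [← h.conforming s hs t ht]
    exact ⟨hxs, hx.1⟩
  have hmem : ∀ a ∈ t, a ≠ c → a ∈ s := fun a ha hac => by_contra fun has =>
    (htri.bary_pos_of_mem_edge hc hx hxt ha hac).ne'
      (htri.bary_eq_zero_of_mem_convexHull_inter ha has hinter)
  obtain ⟨d, hd, hdt⟩ := h.exists_mem_notMem ht hs hst.symm
  have hprop : ∀ y, bary s d y = bary s d c * bary t c y := by
    intro y
    rw [htri.affineMap_apply (bary s d) y, Finset.sum_eq_single c, mul_comm]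
    · intro a ha hac
      rw [hstri.bary_of_ne hd (hmem a ha hac) (fun hda => hdt (hda ▸ ha)), mul_zero]
    · exact fun hc' => absurd hc hc'
  exact ⟨d, hd, ⟨hxs, by rw [hprop, hx.2, mul_zero]⟩, bary s d c, hprop⟩

lemma neg_of_bary_eq_mul (h : IsTriangulation A T) (hs : s ∈ T) (ht : t ∈ T) (hst : s ≠ t)
    (hc : c ∈ t) (hx : x ∈ edge t c) (hxt : x ∉ t) (hd : d ∈ s) (hxd : x ∈ edge s d)
    (hxs : x ∉ s) {κ : ℝ} (hκ : ∀ y, bary s d y = κ * bary t c y) : κ < 0 := by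
  refine lt_of_not_ge fun hκ0 => ?_
  obtain ⟨y, hy, hyt, hys⟩ := (((h.isTriangle ht).frequently_bary_pos hc hx.2).and_eventually
    (((h.isTriangle ht).eventually_mem_iff hc hx hxt).and
      ((h.isTriangle hs).eventually_mem_iff hd hxd hxs))).exists
  exact h.notMem_of_mem_interior hs ht hst (hyt.2.2 hy)
    (hys.1.2 (hκ y ▸ mul_nonneg hκ0 hy.le))

lemma exists_opposite_edge (h : IsTriangulation A T) (hs : s ∈ T) (ht : t ∈ T) (hst : s ≠ t)
    (hc : c ∈ t) (hx : x ∈ edge t c) (hxt : x ∉ t) (hxs : x ∈ convexHull ℝ (s : Set Plane))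
    (hxs' : x ∉ s) : ∃ d ∈ s, x ∈ edge s d ∧ ∃ κ < 0, ∀ y, bary s d y = κ * bary t c y := by
  obtain ⟨d, hd, hxd, κ, hκ⟩ := h.exists_bary_eq_mul hs ht hst hc hx hxt hxs
  exact ⟨d, hd, hxd, κ, h.neg_of_bary_eq_mul hs ht hst hc hx hxt hd hxd hxs' hκ, hκ⟩

lemma eq_or_eq_of_mem_shared_edge (h : IsTriangulation A T) {r : Finset Plane} (hr : r ∈ T)
    (hs : s ∈ T) (ht : t ∈ T) (hst : s ≠ t) (hc : c ∈ t) (hx : x ∈ edge t c)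
    (hxs : x ∈ convexHull ℝ (s : Set Plane)) (hxr : x ∈ convexHull ℝ (r : Set Plane))
    (hv : ∀ t ∈ T, x ∉ t) : r = s ∨ r = t := by
  by_contra! hne
  obtain ⟨d, hd, hxd, κ, hκ, hs_mul⟩ :=
    h.exists_opposite_edge hs ht hst hc hx (hv t ht) hxs (hv s hs)
  obtain ⟨e, he, hxe, μ, hμ, hr_mul⟩ :=
    h.exists_opposite_edge hr ht hne.2 hc hx (hv t ht) hxr (hv r hr)
  refine (div_pos_of_neg_of_neg hμ hκ).not_gt
    (h.neg_of_bary_eq_mul hr hs hne.1 hd hxd (hv s hs) he hxe (hv r hr) fun y => ?_)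
  rw [hr_mul, hs_mul, ← mul_assoc, div_mul_cancel₀ μ hκ.ne]

end IsTriangulation

lemma edgeNormal_eq_neg {κ : ℝ} (hκ : κ < 0) (h : ∀ y, bary s d y = κ * bary t c y) :
    edgeNormal s d = -edgeNormal t c := by
  have hgrad : baryGrad s d = κ • baryGrad t c := by
    refine ext_inner_right ℝ fun v => ?_
    have hs := bary_sub s d v 0
    have ht := bary_sub t c v 0
    rw [sub_zero] at hs ht
    rw [real_inner_smul_left, ← hs, ← ht, h, h, mul_sub]
  rw [edgeNormal, edgeNormal, hgrad, norm_smul, Real.norm_of_nonpos hκ.le, smul_smul, mul_inv,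
    mul_right_comm, inv_neg, neg_mul, inv_mul_cancel₀ hκ.ne, neg_one_mul, neg_smul]

lemma inner_edgeNormal_rot_gradient_congr {q₁ q₂ : Plane → ℝ} (h₁ : DifferentiableAt ℝ q₁ x)
    (h₂ : DifferentiableAt ℝ q₂ x)
    (h : ∀ᶠ y in 𝓝 x, bary t c y = bary t c x → q₁ y = q₂ y) :
    ⟪edgeNormal t c, rot (gradient q₁ x)⟫ = ⟪edgeNormal t c, rot (gradient q₂ x)⟫ := by
  set v := rot (edgeNormal t c) with hv
  have hline : ∀ τ : ℝ, bary t c (x + τ • v) = bary t c x := by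
    intro τ
    rw [← sub_eq_zero, bary_sub, add_sub_cancel_left, hv, edgeNormal, map_neg, map_smul,
      real_inner_smul_right, inner_neg_right, real_inner_smul_right, inner_rot_right,
      inner_rot_self]
    simp only [neg_zero, mul_zero]
  have htend : Tendsto (fun τ : ℝ => x + τ • v) (𝓝 0) (𝓝 x) :=
    (by fun_prop : Continuous fun τ : ℝ => x + τ • v).tendsto' 0 x (by simp)
  have hderiv : lineDeriv ℝ q₁ x v = lineDeriv ℝ q₂ x v :=
    EventuallyEq.deriv_eq ((htend.eventually h).mono fun τ hτ => hτ (hline τ))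
  rw [inner_rot_right, inner_rot_right, ← hv, real_inner_comm, real_inner_comm (gradient q₂ x),
    inner_gradient_left, inner_gradient_left, ← h₁.lineDeriv_eq_fderiv, hderiv,
    h₂.lineDeriv_eq_fderiv]

end

/-! ### Lipschitz domains and exterior normals -/

section

variable {Ω S : Set Plane} {T : Finset (Finset Plane)} {t : Finset Plane} {c n m v x : Plane}

lemma IsLipschitzDomain.mem_closure_compl_closure (h : IsLipschitzDomain Ω)
    (hx : x ∈ frontier Ω) : x ∈ closure (closure Ω)ᶜ := by
  obtain ⟨e, K, f, hf, r, hr, hsub⟩ := h.locally_subgraph x hx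
  have hxf : f ((e x) 0) ≤ (e x) 1 := not_lt.1 fun H =>
    (h.isOpen.frontier_eq ▸ hx).2 ((hsub x (Metric.mem_ball_self hr)).2 H)
  have hcoord : ∀ i, Continuous fun y => (e y) i := fun i =>
    (EuclideanSpace.proj (𝕜 := ℝ) i).continuous.comp e.continuous
  let U : Set Plane := Metric.ball x r ∩ {y | f ((e y) 0) < (e y) 1}
  have hU : IsOpen U :=
    Metric.isOpen_ball.inter (isOpen_lt (hf.continuous.comp (hcoord 0)) (hcoord 1))
  have hUΩ : U ⊆ (closure Ω)ᶜ :=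
    ((Set.disjoint_left.2 fun y hy hyΩ => ((hsub y hy.1).1 hyΩ).not_gt hy.2).closure_right
      hU).subset_compl_right
  let z : ℝ → Plane := fun τ => e.symm (e x + τ • EuclideanSpace.single 1 1)
  have hz : Tendsto z (𝓝[>] 0) (𝓝 x) := by
    have hcont : Continuous z := e.symm.continuous.comp (by fun_prop)
    exact (hcont.tendsto' 0 x (by simp [z])).mono_left nhdsWithin_le_nhds
  refine mem_closure_of_tendsto hz ?_
  filter_upwards [hz.eventually (Metric.ball_mem_nhds x hr), self_mem_nhdsWithin] with τ hball hτ
  refine hUΩ ⟨hball, ?_⟩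
  have hτ' : 0 < τ := hτ
  simpa [z] using by linarith

lemma IsLipschitzDomain.interior_closure_eq (h : IsLipschitzDomain Ω) :
    interior (closure Ω) = Ω := by
  refine Set.Subset.antisymm (fun x hx => ?_) (interior_maximal subset_closure h.isOpen)
  by_contra hxΩ
  have hfr : x ∈ frontier Ω := h.isOpen.frontier_eq ▸ ⟨interior_subset hx, hxΩ⟩
  have hcompl := h.mem_closure_compl_closure hfr
  rw [closure_compl] at hcompl
  exact hcompl hx

lemma IsExteriorNormalAt.eventually_ray (hn : IsExteriorNormalAt Ω x n) (v : Plane) :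
    ∀ᶠ τ : ℝ in 𝓝[>] 0,
      (⟪n, v⟫ < 0 → x + τ • v ∈ Ω) ∧ (0 < ⟪n, v⟫ → x + τ • v ∉ closure Ω) := by
  rcases eq_or_ne ⟪n, v⟫ 0 with h0 | h0
  · exact Eventually.of_forall fun τ => ⟨fun h => absurd h0 h.ne, fun h => absurd h0 h.ne'⟩
  have hv : 0 < ‖v‖ := norm_pos_iff.2 fun hv => h0 (hv ▸ inner_zero_right n)
  have hε : 0 < |⟪n, v⟫| / (2 * ‖v‖) := by positivity
  have hray : Tendsto (fun τ : ℝ => x + τ • v) (𝓝[>] 0) (𝓝 x) :=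
    ((by fun_prop : Continuous fun τ : ℝ => x + τ • v).tendsto' 0 x (by simp)).mono_left
      nhdsWithin_le_nhds
  filter_upwards [hray.eventually (hn.2 _ hε), self_mem_nhdsWithin] with τ hτn hτ
  have hτ' : 0 < τ := hτ
  have hslope : |⟪n, v⟫| / (2 * ‖v‖) * ‖τ • v‖ = τ * |⟪n, v⟫| / 2 := by
    rw [norm_smul, Real.norm_of_nonneg hτ'.le]
    field_simp
  rw [add_sub_cancel_left, real_inner_smul_right, hslope] at hτn
  refine ⟨fun h => hτn.1 ?_, fun h => hτn.2 ?_⟩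
  · rw [abs_of_neg h]
    nlinarith
  · rw [abs_of_pos h]
    nlinarith

lemma IsExteriorNormalAt.unique (hn : IsExteriorNormalAt Ω x n)
    (hm : IsExteriorNormalAt Ω x m) : n = m := by
  by_contra hne
  have hlt : ⟪n, m⟫ < 1 := (inner_lt_one_iff_real_of_norm_eq_one hn.1 hm.1).2 hne
  have hnv : ⟪n, m - n⟫ < 0 := by
    rw [inner_sub_right, real_inner_self_eq_norm_sq, hn.1]
    linarith
  have hmv : 0 < ⟪m, m - n⟫ := by
    rw [inner_sub_right, real_inner_self_eq_norm_sq, hm.1, real_inner_comm]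
    linarith
  obtain ⟨τ, hτn, hτm⟩ := ((hn.eventually_ray (m - n)).and (hm.eventually_ray (m - n))).exists
  exact hτm.2 hmv (subset_closure (hτn.1 hnv))

lemma IsExteriorNormalAt.exteriorNormal_eq (hn : IsExteriorNormalAt Ω x n) :
    exteriorNormal Ω x = n := by
  have h : ∃ n, IsExteriorNormalAt Ω x n := ⟨n, hn⟩
  rw [exteriorNormal, dif_pos h]
  exact h.choose_spec.unique hn

lemma isExteriorNormalAt_edgeNormal (h : IsTriangle t) (hc : c ∈ t) (hx : bary t c x = 0)
    (hin : ∀ᶠ y in 𝓝 x, 0 < bary t c y → y ∈ Ω)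
    (hout : ∀ᶠ y in 𝓝 x, bary t c y < 0 → y ∉ closure Ω) :
    IsExteriorNormalAt Ω x (edgeNormal t c) := by
  refine ⟨h.norm_edgeNormal hc, fun ε hε => ?_⟩
  have hg : 0 < ‖baryGrad t c‖⁻¹ := inv_pos.2 (norm_pos_iff.2 (h.baryGrad_ne_zero hc))
  filter_upwards [hin, hout] with y hyin hyout
  have hε' : 0 ≤ ε * ‖y - x‖ := by positivity
  rw [edgeNormal, inner_neg_left, real_inner_smul_left, ← bary_sub, hx, sub_zero]
  refine ⟨fun H => hyin (pos_of_mul_pos_right ?_ hg.le),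
    fun H => hyout (neg_of_mul_neg_right ?_ hg.le)⟩ <;> linarith

/-! ### Boundary layers near their boundary -/

lemma IsTriangulation.closure_eventuallyEq (h : IsTriangulation (closure S) T) (ht : t ∈ T)
    (honly : ∀ s ∈ T, s ≠ t → x ∉ convexHull ℝ (s : Set Plane)) :
    ∀ᶠ y in 𝓝 x, (y ∈ closure S ↔ y ∈ convexHull ℝ (t : Set Plane)) := by
  have haway : ∀ᶠ y in 𝓝 x, ∀ s ∈ T.erase t, y ∉ convexHull ℝ (s : Set Plane) := by
    rw [Filter.eventually_all_finset]
    intro s hs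
    exact (isCompact_triangle s).isClosed.isOpen_compl.mem_nhds
      (honly s (Finset.mem_of_mem_erase hs) (Finset.ne_of_mem_erase hs))
  filter_upwards [haway] with y hy
  refine ⟨fun hyS => ?_, fun hyt => h.convexHull_subset ht hyt⟩
  rw [← h.covers] at hyS
  obtain ⟨s, hs, hys⟩ := Set.mem_iUnion₂.1 hyS
  by_cases hst : s = t
  · rwa [← hst]
  · exact absurd hys (hy s (Finset.mem_erase.2 ⟨hst, hs⟩))

lemma femGradient_eq {φ q : Plane → ℝ} (h : IsTriangle t)
    (hS : ∀ᶠ y in 𝓝 x, (y ∈ closure S ↔ y ∈ convexHull ℝ (t : Set Plane)))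
    (hx : x ∈ convexHull ℝ (t : Set Plane)) (hq : DifferentiableAt ℝ q x)
    (hφ : Set.EqOn φ q (convexHull ℝ (t : Set Plane))) :
    femGradient S φ x = gradient q x := by
  have hunique : UniqueDiffWithinAt ℝ (convexHull ℝ (t : Set Plane)) x :=
    uniqueDiffWithinAt_convex (convex_convexHull ℝ _) h.interior_nonempty (subset_closure hx)
  rw [femGradient, gradientWithin, gradient, fderivWithin_congr_set (eventuallyEq_set.2 hS),
    fderivWithin_congr hφ (hφ hx), hq.fderivWithin hunique]

namespace IsBoundaryLayer

lemma interior_convexHull_subset (h : IsBoundaryLayer Ω S T) (ht : t ∈ T) :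
    interior (convexHull ℝ (t : Set Plane)) ⊆ S := by
  rw [← h.lipschitz.interior_closure_eq]
  exact interior_mono (h.triangulation.convexHull_subset ht)

lemma notMem_frontier_of_mem (h : IsBoundaryLayer Ω S T) (hx : x ∈ S) : x ∉ frontier Ω :=
  fun hxΩ => (h.lipschitz.isOpen.frontier_eq ▸ h.frontier_subset hxΩ).2 hx

lemma femGradient_eq_of_mem_interior (h : IsBoundaryLayer Ω S T) (ht : t ∈ T)
    {φ q : Plane → ℝ} (hx : x ∈ interior (convexHull ℝ (t : Set Plane)))
    (hq : DifferentiableAt ℝ q x) (hφ : Set.EqOn φ q (convexHull ℝ (t : Set Plane))) :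
    femGradient S φ x = gradient q x := by
  refine femGradient_eq (h.triangulation.isTriangle ht) ?_ (interior_subset hx) hq hφ
  filter_upwards [isOpen_interior.mem_nhds hx] with y hy
  exact iff_of_true (h.triangulation.convexHull_subset ht (interior_subset hy))
    (interior_subset hy)

lemma eventually_notMem_closure (h : IsBoundaryLayer Ω S T) (hΩ : IsLipschitzDomain Ω)
    (ht : IsTriangle t) (hc : c ∈ t) (hx : x ∈ frontier Ω)
    (hcl : ∀ᶠ y in 𝓝 x, (y ∈ closure S ↔ 0 ≤ bary t c y))
    (hin : ∀ᶠ y in 𝓝 x, 0 < bary t c y → y ∈ Ω) :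
    ∀ᶠ y in 𝓝 x, bary t c y < 0 → y ∉ closure Ω := by
  obtain ⟨r, hr, hball⟩ := Metric.eventually_nhds_iff_ball.1 (hcl.and hin)
  let N : Set Plane := Metric.ball x r ∩ {y | bary t c y < 0}
  have hN : IsOpen N := Metric.isOpen_ball.inter
    (isOpen_lt (continuous_bary t c) continuous_const)
  have hNconv : Convex ℝ N := (convex_ball x r).inter
    ((convex_Iio (𝕜 := ℝ) (0 : ℝ)).affine_preimage (bary t c))
  have hNfr : ¬ (N ∩ frontier Ω).Nonempty := fun ⟨y, hy, hyfr⟩ => not_lt.2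
    ((hball y hy.1).1.1 (frontier_subset_closure (h.frontier_subset hyfr))) hy.2
  have hNΩ : ¬ (N ∩ Ω).Nonempty := by
    intro hne
    have hsub : N ⊆ Ω := hNconv.isPreconnected.subset_of_closure_inter_subset hΩ.isOpen hne
      fun y hy => by_contra fun hyΩ => hNfr ⟨y, hy.2, hΩ.isOpen.frontier_eq ▸ ⟨hy.1, hyΩ⟩⟩
    have hballcl : Metric.ball x r ⊆ closure Ω := by
      intro y hy
      rcases lt_trichotomy (bary t c y) 0 with hneg | hzero | hpos
      · exact subset_closure (hsub ⟨hy, hneg⟩)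
      · refine mem_closure_iff_frequently.2 (((ht.frequently_bary_pos hc hzero).and_eventually
          (Metric.isOpen_ball.eventually_mem hy)).mono fun z hz => (hball z hz.2).2 hz.1)
      · exact subset_closure ((hball y hy).2 hpos)
    have hxΩ : x ∈ Ω := by
      rw [← hΩ.interior_closure_eq, mem_interior_iff_mem_nhds]
      exact mem_of_superset (Metric.ball_mem_nhds x hr) hballcl
    exact (hΩ.isOpen.frontier_eq ▸ hx).2 hxΩ
  filter_upwards [Metric.ball_mem_nhds x hr] with y hy hneg hycl
  exact hNΩ (mem_closure_iff.1 hycl N hN ⟨hy, hneg⟩)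

end IsBoundaryLayer

end

/-! ### Cancellation of the fluxes through interior edges -/

/-- The flux `n · curl f` through the boundary of the triangle `t` with exterior unit normal `n`,
as a function on the plane (value `0` off the boundary; the values at the vertices have no
significance). -/
def triangleFlux (t : Finset Plane) (f : Plane → ℝ) (x : Plane) : ℝ :=
  ∑ c ∈ t, (edge t c).indicator (fun y => ⟪edgeNormal t c, rot (gradient f y)⟫) x

/-- The sum of the fluxes of a piecewise smooth function, with piece `q t` on the triangle `t`,
through the boundaries of all triangles of `T`. -/
def edgeFlux (T : Finset (Finset Plane)) (q : Finset Plane → Plane → ℝ) (x : Plane) : ℝ :=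
  ∑ t ∈ T, triangleFlux t (q t) x

section

variable {Ω S A : Set Plane} {T : Finset (Finset Plane)} {s t : Finset Plane} {c x : Plane}
  {φ : Plane → ℝ} {q : Finset Plane → Plane → ℝ}

lemma triangleFlux_of_notMem (hx : x ∉ convexHull ℝ (t : Set Plane)) (f : Plane → ℝ) :
    triangleFlux t f x = 0 :=
  Finset.sum_eq_zero fun _ _ => Set.indicator_of_notMem (fun hx' => hx hx'.1) _

lemma IsTriangle.triangleFlux_eq (h : IsTriangle t) (hc : c ∈ t) (hx : x ∈ edge t c)
    (hxt : x ∉ t) (f : Plane → ℝ) :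
    triangleFlux t f x = ⟪edgeNormal t c, rot (gradient f x)⟫ := by
  rw [triangleFlux, Finset.sum_eq_single_of_mem c hc, Set.indicator_of_mem hx]
  exact fun d hd hdc => Set.indicator_of_notMem
    (fun hxd => (h.bary_pos_of_mem_edge hc hx hxt hd hdc).ne' hxd.2) _

lemma IsTriangulation.triangleFlux_add_eq_zero (h : IsTriangulation A T) (hs : s ∈ T)
    (ht : t ∈ T) (hst : s ≠ t) (hc : c ∈ t) (hx : x ∈ edge t c)
    (hxs : x ∈ convexHull ℝ (s : Set Plane)) (hq : ∀ t ∈ T, Differentiable ℝ (q t))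
    (hφ : ∀ t ∈ T, Set.EqOn φ (q t) (convexHull ℝ (t : Set Plane))) (hv : ∀ t ∈ T, x ∉ t) :
    triangleFlux s (q s) x + triangleFlux t (q t) x = 0 := by
  obtain ⟨d, hd, hxd, κ, hκ, hmul⟩ :=
    h.exists_opposite_edge hs ht hst hc hx (hv t ht) hxs (hv s hs)
  rw [(h.isTriangle hs).triangleFlux_eq hd hxd (hv s hs),
    (h.isTriangle ht).triangleFlux_eq hc hx (hv t ht), edgeNormal_eq_neg hκ hmul, inner_neg_left,
    neg_add_eq_zero]
  refine inner_edgeNormal_rot_gradient_congr (hq s hs x) (hq t ht x) ?_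
  filter_upwards [(h.isTriangle ht).eventually_mem_iff hc hx (hv t ht),
    (h.isTriangle hs).eventually_mem_iff hd hxd (hv s hs)] with y hyt hys hy
  rw [hx.2] at hy
  rw [← hφ t ht (hyt.1.2 hy.ge), ← hφ s hs (hys.1.2 (by rw [hmul, hy, mul_zero]))]

lemma IsTriangulation.edgeFlux_eq_zero_of_mem_shared_edge (h : IsTriangulation A T) (hs : s ∈ T)
    (ht : t ∈ T) (hst : s ≠ t) (hc : c ∈ t) (hx : x ∈ edge t c)
    (hxs : x ∈ convexHull ℝ (s : Set Plane)) (hq : ∀ t ∈ T, Differentiable ℝ (q t))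
    (hφ : ∀ t ∈ T, Set.EqOn φ (q t) (convexHull ℝ (t : Set Plane))) (hv : ∀ t ∈ T, x ∉ t) :
    edgeFlux T q x = 0 := by
  rw [edgeFlux, Finset.sum_eq_add s t hst]
  · exact h.triangleFlux_add_eq_zero hs ht hst hc hx hxs hq hφ hv
  · exact fun r hr hne => triangleFlux_of_notMem (fun hxr =>
      (h.eq_or_eq_of_mem_shared_edge hr hs ht hst hc hx hxs hxr hv).elim hne.1 hne.2) _
  · exact fun hs' => absurd hs hs'
  · exact fun ht' => absurd ht ht'

lemma IsTriangulation.edgeFlux_eq_of_mem_edge (h : IsTriangulation A T) (ht : t ∈ T)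
    (hc : c ∈ t) (hx : x ∈ edge t c) (hxt : x ∉ t)
    (honly : ∀ s ∈ T, s ≠ t → x ∉ convexHull ℝ (s : Set Plane)) :
    edgeFlux T q x = ⟪edgeNormal t c, rot (gradient (q t) x)⟫ := by
  rw [edgeFlux, Finset.sum_eq_single_of_mem t ht, (h.isTriangle ht).triangleFlux_eq hc hx hxt]
  exact fun s hs hst => triangleFlux_of_notMem (honly s hs hst) _

namespace IsBoundaryLayer

lemma notMem_frontier_of_notMem_edge (h : IsBoundaryLayer Ω S T)
    (hx : ∀ t ∈ T, ∀ c ∈ t, x ∉ edge t c) : x ∉ frontier Ω := by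
  intro hxΩ
  have hxcl := frontier_subset_closure (h.frontier_subset hxΩ)
  rw [← h.triangulation.covers] at hxcl
  obtain ⟨t, ht, hxt⟩ := Set.mem_iUnion₂.1 hxcl
  have htri := h.triangulation.isTriangle ht
  refine h.notMem_frontier_of_mem (h.interior_convexHull_subset ht ?_) hxΩ
  exact htri.mem_interior_iff.2 fun c hc => lt_of_le_of_ne (htri.mem_convexHull_iff.1 hxt c hc)
    fun h0 => hx t ht c hc ⟨hxt, h0.symm⟩

lemma mem_of_mem_shared_edge (h : IsBoundaryLayer Ω S T) (hs : s ∈ T) (ht : t ∈ T)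
    (hst : s ≠ t) (hc : c ∈ t) (hx : x ∈ edge t c) (hxt : x ∉ t)
    (hxs : x ∈ convexHull ℝ (s : Set Plane)) (hxs' : x ∉ s) : x ∈ S := by
  have hT := h.triangulation
  obtain ⟨d, hd, hxd, κ, hκ, hmul⟩ := hT.exists_opposite_edge hs ht hst hc hx hxt hxs hxs'
  rw [← h.lipschitz.interior_closure_eq, mem_interior_iff_mem_nhds]
  filter_upwards [(hT.isTriangle ht).eventually_mem_iff hc hx hxt,
    (hT.isTriangle hs).eventually_mem_iff hd hxd hxs'] with y hyt hys
  rcases le_total 0 (bary t c y) with hy | hy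
  · exact hT.convexHull_subset ht (hyt.1.2 hy)
  · exact hT.convexHull_subset hs (hys.1.2 (hmul y ▸ mul_nonneg_of_nonpos_of_nonpos hκ.le hy))

lemma inner_edgeNormal_rot_gradient_eq (h : IsBoundaryLayer Ω S T) (hΩ : IsLipschitzDomain Ω)
    (ht : t ∈ T) (hc : c ∈ t) (hx : x ∈ edge t c) (hxt : x ∉ t)
    (honly : ∀ s ∈ T, s ≠ t → x ∉ convexHull ℝ (s : Set Plane)) (hxΩ : x ∈ frontier Ω)
    {f : Plane → ℝ} (hf : DifferentiableAt ℝ f x)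
    (hφ : Set.EqOn φ f (convexHull ℝ (t : Set Plane))) :
    ⟪edgeNormal t c, rot (gradient f x)⟫ = ⟪exteriorNormal Ω x, femCurl S φ x⟫ := by
  have htri := h.triangulation.isTriangle ht
  have hloc := htri.eventually_mem_iff hc hx hxt
  have hcl := h.triangulation.closure_eventuallyEq ht honly
  have hin : ∀ᶠ y in 𝓝 x, 0 < bary t c y → y ∈ Ω := hloc.mono fun y hy hpos =>
    h.subset (h.interior_convexHull_subset ht (hy.2.2 hpos))
  have hout := h.eventually_notMem_closure hΩ htri hc hxΩ
    ((hcl.and hloc).mono fun y hy => hy.1.trans hy.2.1) hin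
  rw [(isExteriorNormalAt_edgeNormal htri hc hx.2 hin hout).exteriorNormal_eq, femCurl, ← rot_eq,
    femGradient_eq htri hcl hx.1 hf hφ]

lemma inner_edgeNormal_rot_gradient_eq_zero (h : IsBoundaryLayer Ω S T) (ht : t ∈ T)
    (hc : c ∈ t) (hx : x ∈ edge t c) (hxt : x ∉ t)
    (honly : ∀ s ∈ T, s ≠ t → x ∉ convexHull ℝ (s : Set Plane)) (hxΩ : x ∉ frontier Ω)
    {f : Plane → ℝ} (hf : DifferentiableAt ℝ f x)
    (hφ : Set.EqOn φ f (convexHull ℝ (t : Set Plane)))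
    (hzero : ∀ y ∈ innerBoundary Ω S, φ y = 0) :
    ⟪edgeNormal t c, rot (gradient f x)⟫ = 0 := by
  have htri := h.triangulation.isTriangle ht
  have hloc := htri.eventually_mem_iff hc hx hxt
  have hcl : ∀ᶠ y in 𝓝 x, (y ∈ closure S ↔ 0 ≤ bary t c y) :=
    ((h.triangulation.closure_eventuallyEq ht honly).and hloc).mono fun y hy => hy.1.trans hy.2.1
  have hf0 : ∀ᶠ y in 𝓝 x, bary t c y = bary t c x → f y = 0 := by
    filter_upwards [hloc, hcl.eventually_nhds, isClosed_frontier.isOpen_compl.mem_nhds hxΩ]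
      with y hyt hcly hyΩ hy
    rw [hx.2] at hy
    have hyc := hyt.1.2 hy.ge
    rw [← hφ hyc]
    refine hzero y ⟨⟨h.triangulation.convexHull_subset ht hyc, fun hyint => ?_⟩, hyΩ⟩
    obtain ⟨z, hz, hclz, hzint⟩ := ((htri.frequently_bary_neg hc hy).and_eventually
      (hcly.and (isOpen_interior.eventually_mem hyint))).exists
    exact hz.not_ge (hclz.1 (subset_closure (interior_subset hzint)))
  rw [inner_edgeNormal_rot_gradient_congr hf (differentiableAt_const 0) hf0, gradient_fun_const,
    map_zero, inner_zero_right]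

lemma edgeFlux_eq (h : IsBoundaryLayer Ω S T) (hΩ : IsLipschitzDomain Ω)
    (hq : ∀ t ∈ T, Differentiable ℝ (q t))
    (hφ : ∀ t ∈ T, Set.EqOn φ (q t) (convexHull ℝ (t : Set Plane)))
    (hzero : ∀ y ∈ innerBoundary Ω S, φ y = 0) (hv : ∀ t ∈ T, x ∉ t) :
    edgeFlux T q x =
      (frontier Ω).indicator (fun y => ⟪exteriorNormal Ω y, femCurl S φ y⟫) x := by
  by_cases hedge : ∃ t ∈ T, ∃ c ∈ t, x ∈ edge t c
  · obtain ⟨t, ht, c, hc, hx⟩ := hedge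
    by_cases hshared : ∃ s ∈ T, s ≠ t ∧ x ∈ convexHull ℝ (s : Set Plane)
    · obtain ⟨s, hs, hst, hxs⟩ := hshared
      have hxS := h.mem_of_mem_shared_edge hs ht hst hc hx (hv t ht) hxs (hv s hs)
      rw [Set.indicator_of_notMem (h.notMem_frontier_of_mem hxS),
        h.triangulation.edgeFlux_eq_zero_of_mem_shared_edge hs ht hst hc hx hxs hq hφ hv]
    · push Not at hshared
      rw [h.triangulation.edgeFlux_eq_of_mem_edge ht hc hx (hv t ht) hshared]
      by_cases hxΩ : x ∈ frontier Ω
      · rw [Set.indicator_of_mem hxΩ, h.inner_edgeNormal_rot_gradient_eq hΩ ht hc hx (hv t ht)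
          hshared hxΩ (hq t ht x) (hφ t ht)]
      · rw [Set.indicator_of_notMem hxΩ, h.inner_edgeNormal_rot_gradient_eq_zero ht hc hx (hv t ht)
          hshared hxΩ (hq t ht x) (hφ t ht) hzero]
  · push Not at hedge
    rw [Set.indicator_of_notMem (h.notMem_frontier_of_notMem_edge hedge)]
    exact Finset.sum_eq_zero fun t ht => Finset.sum_eq_zero fun c hc =>
      Set.indicator_of_notMem (hedge t ht c hc) _

end IsBoundaryLayer

end

/-! ### Square integrable functions -/

section

variable {α E : Type*} [MeasurableSpace α] {μ : Measure α} [NormedAddCommGroup E]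

lemma memLp_restrict_of_isCompact {X : Type*} [TopologicalSpace X] [T2Space X]
    [MeasurableSpace X] [BorelSpace X] [SecondCountableTopologyEither X E] {ν : Measure X}
    {K : Set X} (hK : IsCompact K) (hν : ν K ≠ ⊤) {f : X → E} (hf : Continuous f)
    (p : ENNReal) : MemLp f p (ν.restrict K) := by
  have : IsFiniteMeasure (ν.restrict K) := isFiniteMeasure_restrict.2 hν
  obtain ⟨C, hC⟩ := hK.exists_bound_of_continuousOn hf.continuousOn
  refine MemLp.of_bound hf.aestronglyMeasurable C ?_
  filter_upwards [ae_restrict_mem hK.measurableSet] with x hx using hC x hx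

lemma tendsto_eLpNorm_sub_sub {p : ENNReal} (hp : 1 ≤ p) {f g : α → E} {F G : ℕ → α → E}
    (hf : AEStronglyMeasurable f μ) (hg : AEStronglyMeasurable g μ)
    (hF : ∀ k, AEStronglyMeasurable (F k) μ) (hG : ∀ k, AEStronglyMeasurable (G k) μ)
    (hfF : Tendsto (fun k => eLpNorm (f - F k) p μ) atTop (𝓝 0))
    (hgG : Tendsto (fun k => eLpNorm (g - G k) p μ) atTop (𝓝 0)) :
    Tendsto (fun k => eLpNorm (f - g - (F k - G k)) p μ) atTop (𝓝 0) := by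
  refine tendsto_of_tendsto_of_tendsto_of_le_of_le tendsto_const_nhds
    (add_zero (0 : ENNReal) ▸ hfF.add hgG) (fun _ => zero_le) fun k => ?_
  rw [sub_sub_sub_comm]
  exact eLpNorm_sub_le (hf.sub (hF k)) (hg.sub (hG k)) hp

variable [InnerProductSpace ℝ E] {f g : α → E}

lemma inner_toLp_toLp (hf : MemLp f 2 μ) (hg : MemLp g 2 μ) :
    ⟪hf.toLp f, hg.toLp g⟫ = ∫ x, ⟪f x, g x⟫ ∂μ := by
  rw [L2.inner_def]
  refine integral_congr_ae ?_
  filter_upwards [hf.coeFn_toLp, hg.coeFn_toLp] with x hfx hgx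
  rw [hfx, hgx]

lemma norm_sq_toLp (hf : MemLp f 2 μ) : ‖hf.toLp f‖ ^ 2 = ∫ x, ‖f x‖ ^ 2 ∂μ := by
  simp only [← real_inner_self_eq_norm_sq, inner_toLp_toLp]

lemma integrable_inner_of_memLp_two (hf : MemLp f 2 μ) (hg : MemLp g 2 μ) :
    Integrable (fun x => ⟪f x, g x⟫) μ := by
  refine (L2.integrable_inner (𝕜 := ℝ) (hf.toLp f) (hg.toLp g)).congr ?_
  filter_upwards [hf.coeFn_toLp, hg.coeFn_toLp] with x hfx hgx
  rw [hfx, hgx]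

lemma integrable_smul_of_memLp_two {r : α → ℝ} (hr : MemLp r 2 μ) (hf : MemLp f 2 μ) :
    Integrable (fun x => r x • f x) μ :=
  memLp_one_iff_integrable.1 (hf.smul hr)

lemma norm_integral_inner_le (hf : MemLp f 2 μ) (hg : MemLp g 2 μ) :
    ‖∫ x, ⟪f x, g x⟫ ∂μ‖ ≤ (eLpNorm f 2 μ).toReal * (eLpNorm g 2 μ).toReal := by
  rw [← inner_toLp_toLp hf hg, ← Lp.norm_toLp f hf, ← Lp.norm_toLp g hg]
  exact norm_inner_le_norm _ _

lemma tendsto_integral_inner {F : ℕ → α → E} (hf : MemLp f 2 μ) (hg : MemLp g 2 μ)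
    (hF : ∀ k, AEStronglyMeasurable (F k) μ)
    (hlim : Tendsto (fun k => eLpNorm (f - F k) 2 μ) atTop (𝓝 0)) :
    Tendsto (fun k => ∫ x, ⟪F k x, g x⟫ ∂μ) atTop (𝓝 (∫ x, ⟪f x, g x⟫ ∂μ)) := by
  rw [tendsto_iff_norm_sub_tendsto_zero]
  have hbound : Tendsto (fun k => (eLpNorm (f - F k) 2 μ).toReal * (eLpNorm g 2 μ).toReal) atTop
      (𝓝 0) := by
    simpa using ((ENNReal.tendsto_toReal ENNReal.zero_ne_top).comp hlim).mul_const
      (eLpNorm g 2 μ).toReal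
  refine squeeze_zero' (Eventually.of_forall fun _ => norm_nonneg _) ?_ hbound
  filter_upwards [hlim.eventually_lt_const ENNReal.zero_lt_top] with k hk
  have hsub : MemLp (f - F k) 2 μ := ⟨hf.1.sub (hF k), hk⟩
  have hFk : MemLp (F k) 2 μ := by simpa only [sub_sub_cancel] using hf.sub hsub
  rw [norm_sub_rev, ← integral_sub (integrable_inner_of_memLp_two hf hg)
    (integrable_inner_of_memLp_two hFk hg)]
  simpa only [Pi.sub_apply, inner_sub_left] using norm_integral_inner_le hsub hg

end

/-! ### Green's formula for finite element functions -/

section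

variable {Ω S : Set Plane} {T : Finset (Finset Plane)} {t : Finset Plane} {c x : Plane}
  {f φ u : Plane → ℝ} {q : Finset Plane → Plane → ℝ}

/-- `φ` is piecewise smooth on the triangulation `T`: on each triangle `t ∈ T` it coincides with
the twice continuously differentiable function `q t`. -/
structure IsPiecewise (T : Finset (Finset Plane)) (φ : Plane → ℝ)
    (q : Finset Plane → Plane → ℝ) : Prop where
  contDiff : ∀ t ∈ T, ContDiff ℝ 2 (q t)
  eqOn : ∀ t ∈ T, Set.EqOn φ (q t) (convexHull ℝ (t : Set Plane))

lemma IsPiecewise.differentiable (h : IsPiecewise T φ q) (ht : t ∈ T) : Differentiable ℝ (q t) :=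
  (h.contDiff t ht).differentiable two_ne_zero

lemma continuous_gradient (hf : ContDiff ℝ 1 f) : Continuous (gradient f) :=
  (InnerProductSpace.toDual ℝ Plane).symm.continuous.comp (hf.continuous_fderiv one_ne_zero)

lemma IsPiecewise.continuous_gradient (h : IsPiecewise T φ q) (ht : t ∈ T) :
    Continuous (gradient (q t)) :=
  BoundaryLayer.continuous_gradient ((h.contDiff t ht).of_le one_le_two)

lemma IsTriangle.hausdorffMeasure_edge_ne_top (h : IsTriangle t) (hc : c ∈ t) :
    (Measure.hausdorffMeasure 1 : Measure Plane) (edge t c) ≠ ⊤ := by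
  obtain ⟨a, b, -, hab⟩ := Finset.card_eq_two.1
    (show (t.erase c).card = 2 by rw [Finset.card_erase_of_mem hc, h.card_eq])
  rw [h.edge_eq hc, hab, Finset.coe_pair, convexHull_pair, hausdorffMeasure_segment]
  exact edist_ne_top a b

lemma IsTriangle.memLp_indicator_edge (h : IsTriangle t) (hc : c ∈ t) (hf : Continuous f)
    (p : ENNReal) : MemLp ((edge t c).indicator f) p (Measure.hausdorffMeasure 1) :=
  (memLp_indicator_iff_restrict (isCompact_edge t c).measurableSet).2
    (memLp_restrict_of_isCompact (isCompact_edge t c) (h.hausdorffMeasure_edge_ne_top hc) hf p)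

lemma continuous_inner_rot_gradient (hf : ContDiff ℝ 2 f) (n : Plane) :
    Continuous fun x => ⟪n, rot (gradient f x)⟫ :=
  continuous_const.inner (rot.continuous.comp (continuous_gradient (hf.of_le one_le_two)))

lemma memLp_edgeFlux (hT : ∀ t ∈ T, IsTriangle t) (hq : ∀ t ∈ T, ContDiff ℝ 2 (q t))
    (p : ENNReal) : MemLp (edgeFlux T q) p (Measure.hausdorffMeasure 1) :=
  memLp_finsetSum _ fun t ht => memLp_finsetSum _ fun _ hc =>
    (hT t ht).memLp_indicator_edge hc (continuous_inner_rot_gradient (hq t ht) _) p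

lemma mul_triangleFlux (f g : Plane → ℝ) (x : Plane) :
    f x * triangleFlux t g x =
      ∑ c ∈ t, (edge t c).indicator (fun y => f y * ⟪edgeNormal t c, rot (gradient g y)⟫) x := by
  simp only [triangleFlux, Finset.mul_sum, Set.indicator_mul_right]

lemma IsTriangle.integrable_indicator_mul_flux (h : IsTriangle t) (hc : c ∈ t) {g : Plane → ℝ}
    (hf : Continuous f) (hg : ContDiff ℝ 2 g) :
    Integrable ((edge t c).indicator fun y => f y * ⟪edgeNormal t c, rot (gradient g y)⟫)
      (Measure.hausdorffMeasure 1) :=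
  memLp_one_iff_integrable.1
    (h.memLp_indicator_edge hc (hf.mul (continuous_inner_rot_gradient hg _)) 1)

lemma IsTriangle.integral_mul_triangleFlux (h : IsTriangle t) {g : Plane → ℝ}
    (hf : ContDiff ℝ 1 f) (hg : ContDiff ℝ 2 g) :
    ∫ x, f x * triangleFlux t g x ∂(Measure.hausdorffMeasure 1) =
      ∫ x in convexHull ℝ (t : Set Plane), ⟪gradient f x, rot (gradient g x)⟫ := by
  simp only [mul_triangleFlux]
  rw [integral_finsetSum _ fun c hc => h.integrable_indicator_mul_flux hc hf.continuous hg,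
    h.green_rot_gradient hf hg]
  exact Finset.sum_congr rfl fun c _ => integral_indicator (isCompact_edge t c).measurableSet

lemma integral_mul_edgeFlux (hT : ∀ t ∈ T, IsTriangle t) (hq : ∀ t ∈ T, ContDiff ℝ 2 (q t))
    (hf : ContDiff ℝ 1 f) :
    ∫ x, f x * edgeFlux T q x ∂(Measure.hausdorffMeasure 1) =
      ∑ t ∈ T, ∫ x in convexHull ℝ (t : Set Plane), ⟪gradient f x, rot (gradient (q t) x)⟫ := by
  simp only [edgeFlux, Finset.mul_sum]
  rw [integral_finsetSum]
  · exact Finset.sum_congr rfl fun t ht => (hT t ht).integral_mul_triangleFlux hf (hq t ht)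
  · intro t ht
    simp only [mul_triangleFlux]
    exact integrable_finsetSum _ fun c hc =>
      (hT t ht).integrable_indicator_mul_flux hc hf.continuous (hq t ht)

lemma interior_convexHull_ae_eq (t : Finset Plane) :
    interior (convexHull ℝ (t : Set Plane)) =ᵐ[volume] convexHull ℝ (t : Set Plane) :=
  interior_ae_eq_of_null_frontier ((convex_convexHull ℝ _).addHaar_frontier volume)

lemma MemH1.isWeakGradient (hu : MemH1 Ω u) : IsWeakGradient Ω u (weakGradient Ω u) := by
  rw [weakGradient, dif_pos hu.2]
  exact hu.2.choose_spec

lemma ae_notMem_vertex (T : Finset (Finset Plane)) :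
    ∀ᵐ x ∂(Measure.hausdorffMeasure 1 : Measure Plane), ∀ t ∈ T, x ∉ t := by
  have := Measure.nullSingletonClass_hausdorff Plane one_pos
  exact (eventually_all_finset T).2 fun t _ => t.finite_toSet.countable.ae_notMem _

namespace IsBoundaryLayer

lemma ae_mem_interior (h : IsBoundaryLayer Ω S T) :
    ∀ᵐ x ∂(volume.restrict S), ∃ t ∈ T, x ∈ interior (convexHull ℝ (t : Set Plane)) := by
  have hint : ∀ᵐ x ∂(volume : Measure Plane), ∀ t ∈ T,
      x ∈ convexHull ℝ (t : Set Plane) → x ∈ interior (convexHull ℝ (t : Set Plane)) :=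
    (eventually_all_finset T).2 fun t _ => (interior_convexHull_ae_eq t).mem_iff.mono
      fun _ hx => hx.2
  filter_upwards [ae_restrict_of_ae hint, ae_restrict_mem h.lipschitz.isOpen.measurableSet]
    with x hx hxS
  have hxcl := subset_closure hxS
  rw [← h.triangulation.covers] at hxcl
  obtain ⟨t, ht, hxt⟩ := Set.mem_iUnion₂.1 hxcl
  exact ⟨t, ht, hx t ht hxt⟩

lemma ae_eq_biUnion_interior (h : IsBoundaryLayer Ω S T) :
    S =ᵐ[volume] ⋃ t ∈ T, interior (convexHull ℝ (t : Set Plane)) := by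
  filter_upwards [(ae_restrict_iff' h.lipschitz.isOpen.measurableSet).1 h.ae_mem_interior]
    with x hx
  refine propext ⟨fun hxS => Set.mem_iUnion₂.2 ?_, fun hxT => ?_⟩
  · simpa only [exists_prop] using hx hxS
  · obtain ⟨t, ht, hxt⟩ := Set.mem_iUnion₂.1 hxT
    exact h.interior_convexHull_subset ht hxt

lemma setIntegral_eq_sum (h : IsBoundaryLayer Ω S T) (hf : IntegrableOn f S) :
    ∫ x in S, f x = ∑ t ∈ T, ∫ x in interior (convexHull ℝ (t : Set Plane)), f x := by
  rw [setIntegral_congr_set h.ae_eq_biUnion_interior]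
  refine integral_biUnion_finset T (fun t _ => isOpen_interior.measurableSet) ?_
    fun t ht => hf.mono_set (h.interior_convexHull_subset ht)
  exact fun s hs t ht hst => Set.disjoint_right.2 fun x hxt hxs =>
    h.triangulation.notMem_of_mem_interior hs ht hst hxt (interior_subset hxs)

lemma femGradient_eq_gradient (h : IsBoundaryLayer Ω S T) (hφ : IsPiecewise T φ q) (ht : t ∈ T)
    (hx : x ∈ interior (convexHull ℝ (t : Set Plane))) : femGradient S φ x = gradient (q t) x :=
  h.femGradient_eq_of_mem_interior ht hx (hφ.differentiable ht x) (hφ.eqOn t ht)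

lemma femGradient_ae_eq (h : IsBoundaryLayer Ω S T) (hφ : IsPiecewise T φ q) :
    femGradient S φ =ᵐ[volume.restrict S] fun x => ∑ t ∈ T,
      (interior (convexHull ℝ (t : Set Plane))).indicator (gradient (q t)) x := by
  filter_upwards [h.ae_mem_interior] with x ⟨t, ht, hx⟩
  rw [h.femGradient_eq_gradient hφ ht hx, Finset.sum_eq_single_of_mem t ht, Set.indicator_of_mem hx]
  exact fun s hs hst => Set.indicator_of_notMem (fun hxs =>
    h.triangulation.notMem_of_mem_interior hs ht hst hx (interior_subset hxs)) _

lemma memLp_femGradient (h : IsBoundaryLayer Ω S T) (hφ : IsPiecewise T φ q) (p : ENNReal) :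
    MemLp (femGradient S φ) p (volume.restrict S) := by
  refine (memLp_congr_ae (h.femGradient_ae_eq hφ)).2 (memLp_finsetSum _ fun t ht => ?_)
  have hcpt := memLp_restrict_of_isCompact (isCompact_triangle t)
    (isCompact_triangle t).measure_lt_top.ne (hφ.continuous_gradient ht) p (ν := volume)
  exact ((memLp_indicator_iff_restrict isOpen_interior.measurableSet).2
    (hcpt.mono_measure (Measure.restrict_mono interior_subset le_rfl))).restrict S

lemma memLp_femCurl (h : IsBoundaryLayer Ω S T) (hφ : IsPiecewise T φ q) (p : ENNReal) :
    MemLp (femCurl S φ) p (volume.restrict S) := by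
  refine ((h.memLp_femGradient hφ p).continuousLinearMap_comp
    (rot : Plane →L[ℝ] Plane)).ae_eq (Eventually.of_forall fun x => ?_)
  exact rot_eq _

lemma integral_inner_femCurl (h : IsBoundaryLayer Ω S T) (hφ : IsPiecewise T φ q)
    {V : Plane → Plane} (hV : MemLp V 2 (volume.restrict S)) :
    ∫ x in S, ⟪V x, femCurl S φ x⟫ =
      ∑ t ∈ T, ∫ x in convexHull ℝ (t : Set Plane), ⟪V x, rot (gradient (q t) x)⟫ := by
  rw [h.setIntegral_eq_sum (integrable_inner_of_memLp_two hV (h.memLp_femCurl hφ 2))]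
  refine Finset.sum_congr rfl fun t ht => ?_
  rw [← setIntegral_congr_set (interior_convexHull_ae_eq t)]
  refine setIntegral_congr_fun isOpen_interior.measurableSet fun x hx => ?_
  rw [femCurl, ← rot_eq, h.femGradient_eq_gradient hφ ht hx]

lemma memLp_of_continuous (h : IsBoundaryLayer Ω S T) {V : Plane → Plane} (hV : Continuous V)
    (p : ENNReal) : MemLp V p (volume.restrict S) := by
  have hcpt : IsCompact (closure S) := by
    rw [← h.triangulation.covers]
    exact T.isCompact_biUnion fun t _ => isCompact_triangle t
  exact (memLp_restrict_of_isCompact hcpt hcpt.measure_lt_top.ne hV p).mono_measure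
    (Measure.restrict_mono subset_closure le_rfl)

lemma edgeFlux_ae_eq (h : IsBoundaryLayer Ω S T) (hΩ : IsLipschitzDomain Ω)
    (hφ : IsPiecewise T φ q) (hzero : ∀ y ∈ innerBoundary Ω S, φ y = 0) :
    edgeFlux T q =ᵐ[Measure.hausdorffMeasure 1]
      (frontier Ω).indicator fun y => ⟪exteriorNormal Ω y, femCurl S φ y⟫ := by
  filter_upwards [ae_notMem_vertex T] with x hx
  exact h.edgeFlux_eq hΩ (fun t ht => hφ.differentiable ht) hφ.eqOn hzero hx

lemma memLp_inner_exteriorNormal_femCurl (h : IsBoundaryLayer Ω S T)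
    (hΩ : IsLipschitzDomain Ω) (hφ : IsPiecewise T φ q)
    (hzero : ∀ y ∈ innerBoundary Ω S, φ y = 0) (p : ENNReal) :
    MemLp (fun y => ⟪exteriorNormal Ω y, femCurl S φ y⟫) p (boundaryMeasure Ω) :=
  (memLp_indicator_iff_restrict isClosed_frontier.measurableSet).1
    ((memLp_edgeFlux (fun _ => h.triangulation.isTriangle) hφ.contDiff p).ae_eq
      (h.edgeFlux_ae_eq hΩ hφ hzero))

lemma boundaryForm_eq_of_contDiff (h : IsBoundaryLayer Ω S T) (hΩ : IsLipschitzDomain Ω)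
    (hφ : IsPiecewise T φ q) (hzero : ∀ y ∈ innerBoundary Ω S, φ y = 0) (hf : ContDiff ℝ 1 f) :
    boundaryForm Ω S f φ = ∫ x in S, ⟪gradient f x, femCurl S φ x⟫ := by
  rw [h.integral_inner_femCurl hφ (h.memLp_of_continuous (continuous_gradient hf) 2),
    ← integral_mul_edgeFlux (fun _ => h.triangulation.isTriangle) hφ.contDiff hf,
    boundaryForm, boundaryMeasure, ← integral_indicator isClosed_frontier.measurableSet]
  refine integral_congr_ae ?_
  filter_upwards [h.edgeFlux_ae_eq hΩ hφ hzero] with x hx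
  rw [hx, Set.indicator_mul_right]

lemma boundaryForm_eq (h : IsBoundaryLayer Ω S T) (hΩ : IsLipschitzDomain Ω)
    (hφ : IsPiecewise T φ q) (hzero : ∀ y ∈ innerBoundary Ω S, φ y = 0) (hu : HasTrace Ω u f) :
    boundaryForm Ω S f φ = ∫ x in S, ⟪weakGradient Ω u x, femCurl S φ x⟫ := by
  obtain ⟨hu1, hf, Φ, hΦ, -, hgrad, htrace⟩ := hu
  have hle : volume.restrict S ≤ volume.restrict Ω := Measure.restrict_mono h.subset le_rfl
  have hboundary := tendsto_integral_inner hf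
    (h.memLp_inner_exteriorNormal_femCurl hΩ hφ hzero 2)
    (fun k => (hΦ k).continuous.aestronglyMeasurable) htrace
  have hinterior := tendsto_integral_inner (hu1.isWeakGradient.1.mono_measure hle)
    (h.memLp_femCurl hφ 2)
    (fun k => (continuous_gradient ((hΦ k).of_le (mod_cast le_top))).aestronglyMeasurable)
    (tendsto_of_tendsto_of_tendsto_of_le_of_le tendsto_const_nhds hgrad (fun _ => zero_le)
      fun _ => eLpNorm_mono_measure _ hle)
  have hmul (a b : ℝ) : ⟪a, b⟫ = a * b := by rw [real_inner_comm]; rfl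
  simp only [hmul] at hboundary
  refine tendsto_nhds_unique hboundary (hinterior.congr fun k => ?_)
  exact (h.boundaryForm_eq_of_contDiff hΩ hφ hzero ((hΦ k).of_le (mod_cast le_top))).symm

end IsBoundaryLayer

/-! ### Traces of differences -/

lemma IsTestFunction.memLp {ψ : Plane → ℝ} (hψ : IsTestFunction Ω ψ) :
    MemLp ψ 2 (volume.restrict Ω) :=
  hψ.1.continuous.memLp_of_hasCompactSupport hψ.2.1

lemma IsTestFunction.memLp_gradient {ψ : Plane → ℝ} (hψ : IsTestFunction Ω ψ) :
    MemLp (gradient ψ) 2 (volume.restrict Ω) :=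
  (continuous_gradient (hψ.1.of_le (mod_cast le_top))).memLp_of_hasCompactSupport
    ((hψ.2.1.fderiv (𝕜 := ℝ)).comp_left (map_zero (InnerProductSpace.toDual ℝ Plane).symm))

lemma IsWeakGradient.ae_eq (hΩ : IsOpen Ω) {G H : Plane → Plane} (hG : IsWeakGradient Ω u G)
    (hH : IsWeakGradient Ω u H) : G =ᵐ[volume.restrict Ω] H := by
  have hloc : LocallyIntegrableOn (G - H) Ω :=
    locallyIntegrableOn_of_locallyIntegrable_restrict
      ((hG.1.sub hH.1).locallyIntegrable one_le_two)
  have hzero := hΩ.ae_eq_zero_of_integral_contDiff_smul_eq_zero hloc fun ψ hsmooth hcpt hsupp => by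
    have hψ : IsTestFunction Ω ψ := ⟨hsmooth, hcpt, hsupp⟩
    rw [← setIntegral_eq_integral_of_forall_compl_eq_zero (s := Ω) fun x hx => by
      rw [image_eq_zero_of_notMem_tsupport (fun hx' => hx (hsupp hx')), zero_smul]]
    simp only [Pi.sub_apply, smul_sub]
    rw [integral_sub (integrable_smul_of_memLp_two hψ.memLp hG.1)
      (integrable_smul_of_memLp_two hψ.memLp hH.1), sub_eq_zero, ← neg_inj, ← hG.2 ψ hψ,
      hH.2 ψ hψ]
  filter_upwards [ae_restrict_of_ae hzero, ae_restrict_mem hΩ.measurableSet] with x hx hxΩ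
  exact sub_eq_zero.1 (hx hxΩ)

lemma IsWeakGradient.sub {v : Plane → ℝ} {G H : Plane → Plane}
    (hu : MemLp u 2 (volume.restrict Ω)) (hv : MemLp v 2 (volume.restrict Ω))
    (hG : IsWeakGradient Ω u G) (hH : IsWeakGradient Ω v H) :
    IsWeakGradient Ω (u - v) (G - H) := by
  refine ⟨hG.1.sub hH.1, fun ψ hψ => ?_⟩
  simp only [Pi.sub_apply, sub_smul, smul_sub]
  rw [integral_sub (integrable_smul_of_memLp_two hu hψ.memLp_gradient)
    (integrable_smul_of_memLp_two hv hψ.memLp_gradient),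
    integral_sub (integrable_smul_of_memLp_two hψ.memLp hG.1)
      (integrable_smul_of_memLp_two hψ.memLp hH.1), hG.2 ψ hψ, hH.2 ψ hψ]
  abel

lemma MemH1.sub {v : Plane → ℝ} (hu : MemH1 Ω u) (hv : MemH1 Ω v) : MemH1 Ω (u - v) :=
  ⟨hu.1.sub hv.1, _, hu.isWeakGradient.sub hu.1 hv.1 hv.isWeakGradient⟩

lemma weakGradient_sub_ae_eq (hΩ : IsOpen Ω) {v : Plane → ℝ} (hu : MemH1 Ω u)
    (hv : MemH1 Ω v) :
    weakGradient Ω (u - v) =ᵐ[volume.restrict Ω] weakGradient Ω u - weakGradient Ω v :=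
  (hu.sub hv).isWeakGradient.ae_eq hΩ (hu.isWeakGradient.sub hu.1 hv.1 hv.isWeakGradient)

lemma gradient_sub {g : Plane → ℝ} (hf : Differentiable ℝ f) (hg : Differentiable ℝ g) :
    gradient (f - g) = gradient f - gradient g := by
  ext1 x
  rw [gradient, fderiv_sub (hf x) (hg x), map_sub]
  rfl

theorem HasTrace.sub (hΩ : IsOpen Ω) {v g : Plane → ℝ} (hu : HasTrace Ω u f)
    (hv : HasTrace Ω v g) : HasTrace Ω (u - v) (f - g) := by
  have haesm {μ : Measure Plane} {F : ℕ → Plane → ℝ} (hF : ∀ k, ContDiff ℝ ∞ (F k)) (k : ℕ) :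
      AEStronglyMeasurable (F k) μ := (hF k).continuous.aestronglyMeasurable
  obtain ⟨hu1, hf, Φ, hΦ, hΦu, hΦgrad, hΦf⟩ := hu
  obtain ⟨hv1, hg, Ψ, hΨ, hΨv, hΨgrad, hΨg⟩ := hv
  have hΦ1 (k : ℕ) : ContDiff ℝ 1 (Φ k) := (hΦ k).of_le (mod_cast le_top)
  have hΨ1 (k : ℕ) : ContDiff ℝ 1 (Ψ k) := (hΨ k).of_le (mod_cast le_top)
  refine ⟨hu1.sub hv1, hf.sub hg, fun k => Φ k - Ψ k, fun k => (hΦ k).sub (hΨ k), ?_, ?_, ?_⟩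
  · exact tendsto_eLpNorm_sub_sub one_le_two hu1.1.1 hv1.1.1 (haesm hΦ) (haesm hΨ) hΦu hΨv
  · refine (tendsto_eLpNorm_sub_sub one_le_two hu1.isWeakGradient.1.1 hv1.isWeakGradient.1.1
      (fun k => (continuous_gradient (hΦ1 k)).aestronglyMeasurable)
      (fun k => (continuous_gradient (hΨ1 k)).aestronglyMeasurable) hΦgrad hΨgrad).congr
      fun k => ?_
    rw [gradient_sub ((hΦ1 k).differentiable one_ne_zero) ((hΨ1 k).differentiable one_ne_zero)]
    exact eLpNorm_congr_ae ((weakGradient_sub_ae_eq hΩ hu1 hv1).symm.sub .rfl)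
  · exact tendsto_eLpNorm_sub_sub one_le_two hf.1 hg.1 (haesm hΦ) (haesm hΨ) hΦf hΨg

end

/-! ### The finite element space -/

section

variable {Ω S : Set Plane} {T : Finset (Finset Plane)} {t : Finset Plane} {p : ℕ}
  {f u w φ ψ : Plane → ℝ} {q r : Finset Plane → Plane → ℝ}

lemma contDiff_eval (P : MvPolynomial (Fin 2) ℝ) {n : WithTop ℕ∞} :
    ContDiff ℝ n fun x : Plane => MvPolynomial.eval (fun i => x i) P := by
  induction P using MvPolynomial.induction_on with
  | C a => simpa only [MvPolynomial.eval_C] using contDiff_const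
  | add P Q hP hQ => simpa only [map_add] using hP.add hQ
  | mul_X P i hP =>
    simp only [map_mul, MvPolynomial.eval_X]
    exact hP.mul (EuclideanSpace.proj (𝕜 := ℝ) i).contDiff

lemma MemFEM.exists_isPiecewise (h : MemFEM p Ω S T φ) : ∃ q, IsPiecewise T φ q := by
  choose! P hP using h.polynomial
  exact ⟨fun t x => MvPolynomial.eval (fun i => x i) (P t),
    fun t _ => contDiff_eval (P t), fun t ht => (hP t ht).2⟩

/-- The finite element space as a vector space of functions on the plane. -/
def femSpace (p : ℕ) (Ω S : Set Plane) (T : Finset (Finset Plane)) :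
    Submodule ℝ (Plane → ℝ) where
  carrier := {φ | MemFEM p Ω S T φ}
  zero_mem' := ⟨continuousOn_const, fun _ _ => ⟨0, by simp, by simp⟩, fun _ _ => rfl,
    fun _ _ => rfl⟩
  add_mem' {φ ψ} hφ hψ := by
    refine ⟨hφ.continuousOn.add hψ.continuousOn, fun t ht => ?_, fun x hx => ?_, fun x hx => ?_⟩
    · obtain ⟨P, hP, hφP⟩ := hφ.polynomial t ht
      obtain ⟨Q, hQ, hψQ⟩ := hψ.polynomial t ht
      exact ⟨P + Q, (MvPolynomial.totalDegree_add P Q).trans (max_le hP hQ), fun x hx => by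
        rw [Pi.add_apply, hφP x hx, hψQ x hx, map_add]⟩
    · rw [Pi.add_apply, hφ.zero_inner x hx, hψ.zero_inner x hx, add_zero]
    · rw [Pi.add_apply, hφ.zero_outside x hx, hψ.zero_outside x hx, add_zero]
  smul_mem' a φ hφ := by
    refine ⟨hφ.continuousOn.const_smul a, fun t ht => ?_, fun x hx => ?_, fun x hx => ?_⟩
    · obtain ⟨P, hP, hφP⟩ := hφ.polynomial t ht
      exact ⟨a • P, (MvPolynomial.totalDegree_smul_le a P).trans hP, fun x hx => by
        rw [Pi.smul_apply, hφP x hx, MvPolynomial.smul_eval, smul_eq_mul]⟩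
    · rw [Pi.smul_apply, hφ.zero_inner x hx, smul_zero]
    · rw [Pi.smul_apply, hφ.zero_outside x hx, smul_zero]

/-- The restriction of polynomials of degree at most `p` to a triangle, as a linear map; its range
is the space of shape functions on that triangle. -/
def polyRestrict (p : ℕ) (t : Finset Plane) :
    MvPolynomial.restrictTotalDegree (Fin 2) ℝ p →ₗ[ℝ] (convexHull ℝ (t : Set Plane) → ℝ) where
  toFun P x := MvPolynomial.eval (fun i => (x : Plane) i) (P : MvPolynomial (Fin 2) ℝ)
  map_add' _ _ := funext fun _ => map_add _ _ _
  map_smul' _ _ := funext fun _ => MvPolynomial.smul_eval _ _ _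

/-- The restriction of finite element functions to the triangles of the triangulation. -/
def femRestrict (p : ℕ) (Ω S : Set Plane) (T : Finset (Finset Plane)) :
    femSpace p Ω S T →ₗ[ℝ] (t : T) → (polyRestrict p t).range where
  toFun φ t := ⟨fun x => φ.1 x, by
    obtain ⟨P, hP, hφP⟩ := φ.2.polynomial t t.2
    exact ⟨⟨P, (MvPolynomial.mem_restrictTotalDegree _ _ _).2 hP⟩,
      funext fun x => (hφP x x.2).symm⟩⟩
  map_add' _ _ := rfl
  map_smul' _ _ := rfl

lemma finiteDimensional_femSpace (hT : IsTriangulation (closure S) T) :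
    FiniteDimensional ℝ (femSpace p Ω S T) := by
  refine FiniteDimensional.of_injective (femRestrict p Ω S T) fun φ ψ h => ?_
  ext x
  by_cases hx : x ∈ closure S
  · rw [← hT.covers] at hx
    obtain ⟨t, ht, hxt⟩ := Set.mem_iUnion₂.1 hx
    exact congrFun (congrArg Subtype.val (congrFun h ⟨t, ht⟩)) ⟨x, hxt⟩
  · rw [φ.2.zero_outside x hx, ψ.2.zero_outside x hx]

lemma IsPiecewise.add (hφ : IsPiecewise T φ q) (hψ : IsPiecewise T ψ r) :
    IsPiecewise T (φ + ψ) (q + r) where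
  contDiff t ht := (hφ.contDiff t ht).add (hψ.contDiff t ht)
  eqOn t ht _ hx := congrArg₂ (· + ·) (hφ.eqOn t ht hx) (hψ.eqOn t ht hx)

lemma IsPiecewise.const_smul (hφ : IsPiecewise T φ q) (a : ℝ) :
    IsPiecewise T (a • φ) (a • q) where
  contDiff t ht := (hφ.contDiff t ht).const_smul a
  eqOn t ht _ hx := congrArg (a • ·) (hφ.eqOn t ht hx)

namespace IsBoundaryLayer

lemma femGradient_add_ae_eq (h : IsBoundaryLayer Ω S T) (hφ : IsPiecewise T φ q)
    (hψ : IsPiecewise T ψ r) :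
    femGradient S (φ + ψ) =ᵐ[volume.restrict S] femGradient S φ + femGradient S ψ := by
  filter_upwards [h.ae_mem_interior] with x ⟨t, ht, hx⟩
  rw [Pi.add_apply, h.femGradient_eq_gradient (hφ.add hψ) ht hx,
    h.femGradient_eq_gradient hφ ht hx, h.femGradient_eq_gradient hψ ht hx, gradient,
    Pi.add_apply, fderiv_add (hφ.differentiable ht x) (hψ.differentiable ht x), map_add]
  rfl

lemma femGradient_smul_ae_eq (h : IsBoundaryLayer Ω S T) (a : ℝ) (hφ : IsPiecewise T φ q) :
    femGradient S (a • φ) =ᵐ[volume.restrict S] a • femGradient S φ := by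
  filter_upwards [h.ae_mem_interior] with x ⟨t, ht, hx⟩
  rw [Pi.smul_apply, h.femGradient_eq_gradient (hφ.const_smul a) ht hx,
    h.femGradient_eq_gradient hφ ht hx, gradient,
    Pi.smul_apply, fderiv_const_smul (hφ.differentiable ht x), map_smul]
  rfl

lemma memLp_femGradient_of_memFEM (h : IsBoundaryLayer Ω S T) (hφ : MemFEM p Ω S T φ) :
    MemLp (femGradient S φ) 2 (volume.restrict S) :=
  h.memLp_femGradient hφ.exists_isPiecewise.choose_spec 2

/-- The gradient of finite element functions as a linear map into `L²(S)`. -/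
def gradL2 (h : IsBoundaryLayer Ω S T) (p : ℕ) :
    femSpace p Ω S T →ₗ[ℝ] Lp Plane 2 (volume.restrict S) where
  toFun φ := (h.memLp_femGradient_of_memFEM φ.2).toLp _
  map_add' φ ψ := by
    rw [← MemLp.toLp_add]
    exact MemLp.toLp_congr _ _ (h.femGradient_add_ae_eq
      (MemFEM.exists_isPiecewise φ.2).choose_spec (MemFEM.exists_isPiecewise ψ.2).choose_spec)
  map_smul' a φ := by
    rw [RingHom.id_apply, ← MemLp.toLp_const_smul]
    exact MemLp.toLp_congr _ _ (h.femGradient_smul_ae_eq a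
      (MemFEM.exists_isPiecewise φ.2).choose_spec)

lemma inner_gradL2 (h : IsBoundaryLayer Ω S T) (φ ψ : femSpace p Ω S T) :
    ⟪h.gradL2 p φ, h.gradL2 p ψ⟫ = ∫ x in S, ⟪femGradient S φ x, femGradient S ψ x⟫ :=
  inner_toLp_toLp (h.memLp_femGradient_of_memFEM φ.2) (h.memLp_femGradient_of_memFEM ψ.2)

lemma norm_sq_gradL2 (h : IsBoundaryLayer Ω S T) (φ : femSpace p Ω S T) :
    ‖h.gradL2 p φ‖ ^ 2 = ∫ x in S, ‖femGradient S φ x‖ ^ 2 :=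
  norm_sq_toLp (h.memLp_femGradient_of_memFEM φ.2)

lemma gradient_eq_zero_of_femGradient_ae_eq_zero (h : IsBoundaryLayer Ω S T)
    (hφ : IsPiecewise T φ q) (hzero : femGradient S φ =ᵐ[volume.restrict S] 0) (ht : t ∈ T) :
    Set.EqOn (gradient (q t)) 0 (interior (convexHull ℝ (t : Set Plane))) := by
  refine Measure.eqOn_open_of_ae_eq (μ := volume) ?_ isOpen_interior
    (hφ.continuous_gradient ht).continuousOn continuousOn_const
  filter_upwards [ae_restrict_of_ae_restrict_of_subset (h.interior_convexHull_subset ht) hzero,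
    ae_restrict_mem isOpen_interior.measurableSet] with x hx hxt
  rw [← h.femGradient_eq_gradient hφ ht hxt, hx]

end IsBoundaryLayer

lemma IsTriangle.eqOn_const_of_gradient_eq_zero (ht : IsTriangle t) (hf : Differentiable ℝ f)
    (hzero : Set.EqOn (gradient f) 0 (interior (convexHull ℝ (t : Set Plane)))) :
    ∃ k, Set.EqOn f (fun _ => k) (convexHull ℝ (t : Set Plane)) := by
  have hconv := convex_convexHull ℝ (t : Set Plane)
  have hfderiv : Set.EqOn (fderiv ℝ f) 0 (interior (convexHull ℝ (t : Set Plane))) :=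
    fun x hx => by rw [← toDual_gradient, hzero hx, Pi.zero_apply, map_zero, Pi.zero_apply]
  obtain ⟨z, hz⟩ := ht.interior_nonempty
  refine ⟨f z, Set.EqOn.of_subset_closure (fun y hy => ?_) hf.continuous.continuousOn
    continuousOn_const interior_subset ?_⟩
  · exact isOpen_interior.is_const_of_fderiv_eq_zero (𝕜 := ℝ) hconv.interior.isPreconnected
      hf.differentiableOn hfderiv hy hz
  · rw [hconv.closure_interior_eq_closure_of_nonempty_interior ⟨z, hz⟩]
    exact subset_closure

namespace IsBoundaryLayer

lemma eqOn_zero_of_piecewise_const (h : IsBoundaryLayer Ω S T)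
    (hne : (innerBoundary Ω S).Nonempty) (hφ : MemFEM p Ω S T φ)
    (hconst : ∀ t ∈ T, ∃ k, Set.EqOn φ (fun _ => k) (convexHull ℝ (t : Set Plane))) :
    Set.EqOn φ 0 (closure S) := by
  choose! k hk using hconst
  obtain ⟨y, hy⟩ := hne
  have hmaps : Set.MapsTo φ (closure S) (k '' T) := by
    intro x hx
    rw [← h.triangulation.covers] at hx
    obtain ⟨t, ht, hxt⟩ := Set.mem_iUnion₂.1 hx
    exact ⟨t, ht, (hk t ht hxt).symm⟩
  intro x hx
  rw [h.lipschitz.isConnected.closure.isPreconnected.constant_of_mapsTo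
    (T.finite_toSet.image k).isDiscrete hφ.continuousOn hmaps hx
    (frontier_subset_closure hy.1), hφ.zero_inner y hy, Pi.zero_apply]

lemma injective_gradL2 (h : IsBoundaryLayer Ω S T) (hne : (innerBoundary Ω S).Nonempty) :
    Function.Injective (h.gradL2 p) := by
  refine (injective_iff_map_eq_zero _).2 fun φ hφ => ?_
  have hgrad : femGradient S φ =ᵐ[volume.restrict S] 0 :=
    (MemLp.toLp_eq_toLp_iff (h.memLp_femGradient_of_memFEM φ.2) MemLp.zero).1 hφ
  obtain ⟨q, hq⟩ := MemFEM.exists_isPiecewise φ.2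
  ext x
  by_cases hx : x ∈ closure S
  · refine h.eqOn_zero_of_piecewise_const hne φ.2 (fun t ht => ?_) hx
    obtain ⟨k, hk⟩ := (h.triangulation.isTriangle ht).eqOn_const_of_gradient_eq_zero
      (hq.differentiable ht) (h.gradient_eq_zero_of_femGradient_ae_eq_zero hq hgrad ht)
    exact ⟨k, (hq.eqOn t ht).trans hk⟩
  · exact φ.2.zero_outside x hx

end IsBoundaryLayer

/-! ### The Galerkin problem as an orthogonal projection -/

lemma existsUnique_inner_map_eq {V H : Type*} [AddCommGroup V] [Module ℝ V]
    [FiniteDimensional ℝ V] [NormedAddCommGroup H] [InnerProductSpace ℝ H] {L : V →ₗ[ℝ] H}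
    (hL : Function.Injective L) (F : H) : ∃! w, ∀ φ, ⟪L w, L φ⟫ = ⟪F, L φ⟫ := by
  obtain ⟨w, hw⟩ : L.range.starProjection F ∈ L.range := Submodule.starProjection_apply_mem _ _
  have hwF (φ : V) : ⟪L w, L φ⟫ = ⟪F, L φ⟫ := by
    rw [hw, eq_comm, ← sub_eq_zero, ← inner_sub_left]
    exact Submodule.starProjection_inner_eq_zero _ _ ⟨φ, rfl⟩
  refine ⟨w, hwF, fun w' hw' => hL (sub_eq_zero.1 ((inner_self_eq_zero (𝕜 := ℝ)).1 ?_))⟩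
  calc ⟪L w' - L w, L w' - L w⟫ = ⟪L w', L (w' - w)⟫ - ⟪L w, L (w' - w)⟫ := by
        rw [← inner_sub_left, map_sub]
    _ = 0 := by rw [hw', hwF, sub_self]

namespace IsBoundaryLayer

lemma exists_boundaryForm_eq_inner (h : IsBoundaryLayer Ω S T) (hΩ : IsLipschitzDomain Ω)
    (p : ℕ) (hu : HasTrace Ω u f) : ∃ F : Lp Plane 2 (volume.restrict S),
      (∀ φ : femSpace p Ω S T, boundaryForm Ω S f φ = ⟪F, h.gradL2 p φ⟫) ∧
      ‖F‖ ^ 2 ≤ ∫ x in Ω, ‖weakGradient Ω u x‖ ^ 2 := by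
  have hG := hu.1.isWeakGradient.1
  have hrot : MemLp (fun x => rot (weakGradient Ω u x)) 2 (volume.restrict S) :=
    (hG.mono_measure (Measure.restrict_mono h.subset le_rfl)).continuousLinearMap_comp
      (rot : Plane →L[ℝ] Plane)
  refine ⟨-hrot.toLp _, fun φ => ?_, ?_⟩
  · obtain ⟨q, hq⟩ := MemFEM.exists_isPiecewise φ.2
    rw [h.boundaryForm_eq hΩ hq φ.2.zero_inner hu, inner_neg_left]
    refine Eq.trans ?_ (congrArg Neg.neg
      (inner_toLp_toLp hrot (h.memLp_femGradient_of_memFEM φ.2)).symm)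
    simp only [← integral_neg, femCurl, ← rot_eq, inner_rot_right]
  · rw [norm_neg, norm_sq_toLp]
    simp only [rot.norm_map]
    exact setIntegral_mono_set (MemLp.integrable_norm_pow (p := 2) hG two_ne_zero)
      (Eventually.of_forall fun x => sq_nonneg _) (Eventually.of_forall h.subset)

lemma existsUnique_solvesDiscrete (h : IsBoundaryLayer Ω S T)
    (hne : (innerBoundary Ω S).Nonempty) {F : Lp Plane 2 (volume.restrict S)}
    (hF : ∀ φ : femSpace p Ω S T, boundaryForm Ω S f φ = ⟪F, h.gradL2 p φ⟫) :
    ∃! w, SolvesDiscrete p Ω S T f w := by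
  have := finiteDimensional_femSpace (p := p) (Ω := Ω) h.triangulation
  have hiff (w : femSpace p Ω S T) : SolvesDiscrete p Ω S T f w ↔
      ∀ φ : femSpace p Ω S T, ⟪h.gradL2 p w, h.gradL2 p φ⟫ = ⟪F, h.gradL2 p φ⟫ := by
    simp only [← hF, inner_gradL2]
    exact ⟨fun hw φ => hw.2 φ φ.2, fun hw => ⟨w.2, fun φ hφ => hw ⟨φ, hφ⟩⟩⟩
  obtain ⟨w, hw, huniq⟩ := existsUnique_inner_map_eq (h.injective_gradL2 (p := p) hne) F
  exact ⟨w, (hiff w).2 hw, fun w' hw' =>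
    congrArg Subtype.val (huniq ⟨w', hw'.1⟩ ((hiff ⟨w', hw'.1⟩).1 hw'))⟩

end IsBoundaryLayer

lemma two_mul_inner_sub_norm_sq_le {H : Type*} [NormedAddCommGroup H] [InnerProductSpace ℝ H]
    (x y : H) : 2 * ⟪x, y⟫ - ‖y‖ ^ 2 ≤ ‖x‖ ^ 2 := by
  linarith [norm_sub_sq_real x y, sq_nonneg ‖x - y‖]

end

end

end BoundaryLayer

theorem corollary3p3_general {Ω S : Set Plane} {T : Finset (Finset Plane)}
    (hΩ : IsLipschitzDomain Ω) (hS : IsBoundaryLayer Ω S T) (p : ℕ) {u f : Plane → ℝ}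
    (hu : HasTrace Ω u f) :
    ((innerBoundary Ω S).Nonempty → ∃! w : Plane → ℝ, SolvesDiscrete p Ω S T f w) ∧
    ∀ w : Plane → ℝ, MemFEM p Ω S T w →
      2 * boundaryForm Ω S f w - ∫ x in S, ‖femGradient S w x‖ ^ 2
        ≤ ∫ x in Ω, ‖weakGradient Ω u x‖ ^ 2 := by
  obtain ⟨F, hF, hFu⟩ := hS.exists_boundaryForm_eq_inner hΩ p hu
  refine ⟨fun hne => hS.existsUnique_solvesDiscrete hne hF, fun w hw => ?_⟩
  lift w to femSpace p Ω S T using hw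
  rw [hF, ← hS.norm_sq_gradL2]
  exact (two_mul_inner_sub_norm_sq_le F _).trans hFu

theorem corollary3p3 (Ω S : Set Plane) (T : Finset (Finset Plane))
    (hΩ : IsLipschitzDomain Ω) (hΩb : Bornology.IsBounded Ω)
    (hS : IsBoundaryLayer Ω S T) (p : ℕ) (hp : 1 ≤ p)
    (g u : Plane → ℝ) (hu : SolvesDirichlet Ω g u)
    (v vΓ : Plane → ℝ) (hv : IsHarmonicH1 Ω v) (hvΓ : HasTrace Ω v vΓ) :
    ((innerBoundary Ω S).Nonempty → ∃! w : Plane → ℝ, SolvesDiscrete p Ω S T (g - vΓ) w) ∧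
    ∀ w : Plane → ℝ, SolvesDiscrete p Ω S T (g - vΓ) w →
      2 * boundaryForm Ω S (g - vΓ) w - ∫ x in S, ‖femGradient S w x‖ ^ 2
        ≤ ∫ x in Ω, ‖weakGradient Ω (u - v) x‖ ^ 2 :=
  (corollary3p3_general hΩ hS p (hu.2.sub hΩ.isOpen hvΓ)).imp_right
    fun h w hw => h w hw.1
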